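/- Let $(\Omega,\mathscr F,\mathbf P)$ be a probability space, and let $\mathbf S_{\rm toch}$ be the set of jointly measurable, stochastically continuous processes $Z:[0,\infty)\times\Omega\to\mathbb R^d$. Fix $\chi\in C_c^\infty(\mathbb R^d)$ with $\chi(x)=1$ for $|x|\le 1$ and $\chi(x)=0$ for $|x|>2$, and fix $r>0$. For $p,q\in(1,\infty)$ and $T>0$ let $\widetilde{\mathbb L}^p_q(T)$ be the set of Borel functions $f:[0,\infty)\times\mathbb R^d\to\mathbb R$, $(t,x)\mapsto f_t(x)$, with $$\|f\|_{\widetilde{\mathbb L}^p_q(T)}:=\sup_{z\in\mathbb R^d}\Big(\int_0^T\big\|\chi(\tfrac{\cdot-z}{r})f_t\big\|_{L^p(\mathbb R^d)}^q\,dt\Big)^{1/q}<\infty .$$ For $\kappa>0$, write $Z\in\mathbf K^{p,q}_{T,\kappa}$ if $Z\in\mathbf S_{\rm toch}$ and $\mathbf E\int_0^T f_t(Z_t)\,dt\le\kappa\|f\|_{\widetilde{\mathbb L}^p_q(T)}$ for every $f\in\widetilde{\mathbb L}^p_q(T)$ (the left-hand side being well defined; equivalently, the estimate holds with $|f|$ in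 place of $f$). With $Q_z:=\prod_{i=1}^d(z_i,z_i+1]$, for a finite-dimensional real normed space $F$ (for example $\mathbb R$ or $\mathbb R^d$) let $\widetilde{\mathbb L}^{p_1,p_2}_{q_0}(T)$ be the set of Borel functions $f:[0,\infty)\times\mathbb R^d\times\mathbb R^d\to F$ with $$\sup_{z,z'\in\mathbb R^d}\Big(\int_0^T\Big(\int_{Q_{z'}}\|\mathbf 1_{Q_z}f_t(\cdot,y)\|_{L^{p_1}}^{p_2}\,dy\Big)^{q_0/p_2}dt\Big)^{1/q_0}<\infty .$$ **Lemma 2.9.** Let $X^n,Y^n$ ($n\in\mathbb N$), $X,Y\in\mathbf S_{\rm toch}$ be such that for each $t\ge 0$, $X^n_t\to X_t$ almost surely and $Y^n_t\to Y_t$ in distribution. Let $p_1,p_2,q_0,q_1,q_2\in(1,\infty)$ with $\frac1{q_1}+\frac1{q_2}=1+\frac1{q_0}$, and let $T,\beta,\kappa>0$. Suppose that $X^n\in\mathbf K^{p_1,q_1}_{T,\kappa}$ and $Y^n\in\mathbf K^{p_2,q_2}_{T,\kappa}$ for each $n$, and that for some constant $C_1$, $$\sup_n\sup_{t\in[0,T]}\mathbf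 E\big(|X^n_t|^\beta+|Y^n_t|^\beta\big)\le C_1 .$$ Let $\gamma>1$ and $\bar b\in\widetilde{\mathbb L}^{\gamma p_1,\gamma p_2}_{\gamma q_0}(T)$, and put $b_t(x,\mu):=\int_{\mathbb R^d}\bar b_t(x,y)\,\mu(dy)$ and $b^Z_t(x):=b_t(x,\mathbf P\circ Z_t^{-1})$. Then the integrals defining $b^{Y^n}_t(X^n_t)$ (for each $n$) and $b^Y_t(X_t)$ converge absolutely for almost all $(t,\omega)\in[0,T]\times\Omega$, and $$\lim_{n\to\infty}\mathbf E\Big(\int_0^T\big|b^{Y^n}_t(X^n_t)-b^Y_t(X_t)\big|\,dt\Big)=0 .$$ (No weak continuity of $\mu\mapsto b_t(x,\mu)$ is assumed.) -/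

import Mathlib

open MeasureTheory ProbabilityTheory Filter Topology
open scoped NNReal ENNReal

noncomputable section

/-- A smooth compactly supported cut-off function, equal to `1` on the closed unit ball and to `0`
outside the closed ball of radius `2`. -/
structure IsCutoff {d : ℕ} (χ : EuclideanSpace ℝ (Fin d) → ℝ) : Prop where
  contDiff : ContDiff ℝ ((⊤ : ℕ∞) : WithTop ℕ∞) χ
  hasCompactSupport : HasCompactSupport χ
  eq_one : ∀ x, ‖x‖ ≤ 1 → χ x = 1
  eq_zero : ∀ x, 2 < ‖x‖ → χ x = 0

/-- The shifted and rescaled cut-off `x ↦ χ ((x - z) / r)`. -/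
def cutoffAt {d : ℕ} (χ : EuclideanSpace ℝ (Fin d) → ℝ) (r : ℝ) (z x : EuclideanSpace ℝ (Fin d)) :
    ℝ :=
  χ (r⁻¹ • (x - z))

/-- Lebesgue measure on the time interval `[0, T]`, as a measure on the time axis `ℝ≥0`. -/
def timeMeasure (T : ℝ≥0) : Measure ℝ≥0 :=
  (volume.restrict (Set.Icc (0 : ℝ) T)).map Real.toNNReal

/-- The localized space-time norm
`sup_z (∫₀ᵀ ‖χ((· - z) / r) f_t‖_{L^p(ℝ^d)}^q dt)^(1/q)` (an extended nonnegative number). -/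
def locNorm {d : ℕ} (χ : EuclideanSpace ℝ (Fin d) → ℝ) (r : ℝ) (p q : ℝ≥0∞) (T : ℝ≥0)
    (f : ℝ≥0 → EuclideanSpace ℝ (Fin d) → ℝ) : ℝ≥0∞ :=
  ⨆ z : EuclideanSpace ℝ (Fin d),
    eLpNorm (fun t => eLpNorm (fun x => cutoffAt χ r z x * f t x) p volume) q
      (timeMeasure T)

/-- Membership in the localized space-time Lebesgue space on `[0, T]`. -/
def MemLoc {d : ℕ} (χ : EuclideanSpace ℝ (Fin d) → ℝ) (r : ℝ) (p q : ℝ≥0∞) (T : ℝ≥0)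
    (f : ℝ≥0 → EuclideanSpace ℝ (Fin d) → ℝ) : Prop :=
  Measurable (Function.uncurry f) ∧ locNorm χ r p q T f < ∞

/-- The half-open unit cube `∏ᵢ (zᵢ, zᵢ + 1]`. -/
def unitCube {d : ℕ} (z : EuclideanSpace ℝ (Fin d)) : Set (EuclideanSpace ℝ (Fin d)) :=
  {x | ∀ i, z i < x i ∧ x i ≤ z i + 1}

/-- The localized mixed norm of a function `f_t(x, y)`:
`sup_{z,z'} (∫₀ᵀ (∫_{Q_{z'}} ‖1_{Q_z} f_t(·, y)‖_{p₁}^{p₂} dy)^{q₀/p₂} dt)^{1/q₀}`. -/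
def locMixedNorm {d : ℕ} {F : Type*} [NormedAddCommGroup F] (p₁ p₂ q₀ : ℝ≥0∞) (T : ℝ≥0)
    (f : ℝ≥0 → EuclideanSpace ℝ (Fin d) → EuclideanSpace ℝ (Fin d) → F) : ℝ≥0∞ :=
  ⨆ (z : EuclideanSpace ℝ (Fin d)) (z' : EuclideanSpace ℝ (Fin d)),
    eLpNorm (fun t =>
      eLpNorm (fun y =>
        eLpNorm (fun x => f t x y) p₁ (volume.restrict (unitCube z)))
        p₂ (volume.restrict (unitCube z')))
      q₀ (timeMeasure T)

/-- Membership in the localized mixed-norm Lebesgue space on `[0, T]`. -/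
def MemLocMixed {d : ℕ} {F : Type*} [NormedAddCommGroup F] [MeasurableSpace F]
    (p₁ p₂ q₀ : ℝ≥0∞) (T : ℝ≥0)
    (f : ℝ≥0 → EuclideanSpace ℝ (Fin d) → EuclideanSpace ℝ (Fin d) → F) : Prop :=
  Measurable (fun a : ℝ≥0 × EuclideanSpace ℝ (Fin d) × EuclideanSpace ℝ (Fin d) =>
    f a.1 a.2.1 a.2.2) ∧ locMixedNorm p₁ p₂ q₀ T f < ∞

/-- Jointly measurable, stochastically continuous `ℝ^d`-valued processes indexed by `[0, ∞)`. -/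
structure IsStochContProcess {d : ℕ} {Ω : Type*} [MeasurableSpace Ω] (P : Measure Ω)
    (X : ℝ≥0 → Ω → EuclideanSpace ℝ (Fin d)) : Prop where
  measurable : Measurable (Function.uncurry X)
  stochCont : ∀ t, TendstoInMeasure P X (𝓝 t) (X t)

/-- Krylov's estimate with index `p, q` and constant `κ` on `[0, T]`:
`E ∫₀ᵀ f_t(X_t) dt ≤ κ ⦀f⦀` for all `f` in the localized space. The space and its norm are invariant
under `f ↦ |f|`, so the estimate is stated with `|f|`; this includes that the left-hand side
is well defined. -/
def KrylovEstimate {d : ℕ} {Ω : Type*} [MeasurableSpace Ω] (P : Measure Ω)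
    (χ : EuclideanSpace ℝ (Fin d) → ℝ) (r : ℝ) (p q : ℝ≥0∞) (T κ : ℝ≥0)
    (X : ℝ≥0 → Ω → EuclideanSpace ℝ (Fin d)) : Prop :=
  ∀ f : ℝ≥0 → EuclideanSpace ℝ (Fin d) → ℝ, MemLoc χ r p q T f →
    ∫⁻ ω, ∫⁻ t, ‖f t (X t ω)‖ₑ ∂(timeMeasure T) ∂P ≤ (κ : ℝ≥0∞) * locNorm χ r p q T f

/-- The distribution dependent drift `b_t(x, μ) = ∫ b̄_t(x, y) μ(dy)`. -/
def meanFieldDrift {d : ℕ} {F : Type*} [NormedAddCommGroup F] [NormedSpace ℝ F]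
    (bbar : ℝ≥0 → EuclideanSpace ℝ (Fin d) → EuclideanSpace ℝ (Fin d) → F)
    (t : ℝ≥0) (x : EuclideanSpace ℝ (Fin d)) (μ : Measure (EuclideanSpace ℝ (Fin d))) : F :=
  ∫ y, bbar t x y ∂μ

/-- For a distribution dependent `b`, the field `b^Z_t(x) = b_t(x, law of Z_t)`. -/
def driftAlong {d : ℕ} {F : Type*} {Ω : Type*} [MeasurableSpace Ω] (P : Measure Ω)
    (b : ℝ≥0 → EuclideanSpace ℝ (Fin d) → Measure (EuclideanSpace ℝ (Fin d)) → F)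
    (Z : ℝ≥0 → Ω → EuclideanSpace ℝ (Fin d)) (t : ℝ≥0) (x : EuclideanSpace ℝ (Fin d)) : F :=
  b t x (P.map (Z t))

end

/-! Let `m_n` be the law of `(t, X^n_t, Y'_t)` under `dt ⊗ P ⊗ P`, where `Y'` is an independent copy
of `Y^n`, and let `m` be the corresponding law for `X, Y`. Since `b^{Y^n}_t(X^n_t)` integrates out
only the independent copy, all errors are controlled by `L^1` norms under these laws.

The two Krylov estimates combine into one for the pair, `∫ g dm_n ≤ C ‖g‖` in the mixed norm with
exponents `p₁, p₂, q₀` (`lintegral_pair_le_cubeMixedNorm`). Krylov for `X^n` is applied to `E g(t,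
x, Y^n_t)`, Minkowski moves the `p₁`-norm inside the expectation, and the remaining `L^{q₁}` norm in
time is tested by duality against `φ(t)`. Krylov for `Y^n` then applies to `φ(t) ‖g(t, ·, y)‖_{p₁}`,
and the exponent relation is exactly what Hölder in time needs to split off `φ`.

This has two consequences, uniform in `n`: the `m_n` are controlled by an `L^p` norm for a single
finite `p`, and, with `g = |b̄|^γ`, the `γ`-moments of `b̄` are bounded. Together with tightness
from the `β`-moments, `b̄` is approximated in every `L^1(m_n)` at once by one continuous, compactly
supported `c` (`exists_hasCompactSupport_forall_lintegral_le`). For such `c` the convergence is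
elementary (`tendsto_lintegral_enorm_sub_of_hasCompactSupport`), so a three-term estimate concludes.
This is why no continuity in the measure argument is needed.

The limit term must be approximated too, although no Krylov estimate is assumed for `X, Y`. The
required bounds pass from `m_n` to `m` by the same approximation
(`lintegral_jointLaw_le_of_forall`). -/

/-- The `L^p` functional `(∫ f ^ p) ^ (1 / p)` of an extended nonnegative function. -/
noncomputable def powNorm {α : Type*} [MeasurableSpace α] (p : ℝ) (μ : Measure α) (f : α → ℝ≥0∞) :
    ℝ≥0∞ :=
  (∫⁻ x, f x ^ p ∂μ) ^ (1 / p)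

/-! ### `L^p` functionals on `[0, ∞]`-valued functions: duality and Minkowski. -/

section PowNorm

variable {α β : Type*} [MeasurableSpace α] [MeasurableSpace β] {μ : Measure α} {ν : Measure β}
  {f g : α → ℝ≥0∞} {p q r : ℝ}

/-- Fatou's lemma. Only upper bounds are ever transferred, so neither monotonicity nor domination is
required. -/
lemma lintegral_le_of_forall_tendsto {F : ℕ → α → ℝ≥0∞} {A : ℝ≥0∞} (hF : ∀ n, Measurable (F n))
    (hlim : ∀ x, Tendsto (fun n => F n x) atTop (𝓝 (f x))) (hA : ∀ n, ∫⁻ x, F n x ∂μ ≤ A) :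
    ∫⁻ x, f x ∂μ ≤ A := by
  have h : ∀ x, f x = liminf (fun n => F n x) atTop := fun x => (hlim x).liminf_eq.symm
  simp_rw [h]
  refine (lintegral_liminf_le hF).trans ?_
  exact (liminf_le_liminf (Eventually.of_forall hA)).trans (by simp)

lemma tendsto_min_natCast (a : ℝ≥0∞) :
    Tendsto (fun n : ℕ => min a (n : ℝ≥0∞)) atTop (𝓝 a) := by
  have h := (tendsto_const_nhds (x := a)).min ENNReal.tendsto_nat_nhds_top
  simpa using h

lemma powNorm_rpow (hp : 0 < p) : powNorm p μ f ^ p = ∫⁻ x, f x ^ p ∂μ := by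
  rw [powNorm, ← ENNReal.rpow_mul, one_div_mul_cancel hp.ne', ENNReal.rpow_one]

lemma powNorm_le_iff (hp : 0 < p) {A : ℝ≥0∞} : powNorm p μ f ≤ A ↔ ∫⁻ x, f x ^ p ∂μ ≤ A ^ p := by
  rw [← powNorm_rpow hp, ENNReal.rpow_le_rpow_iff hp]

lemma powNorm_mono (hp : 0 < p) (h : ∀ x, f x ≤ g x) : powNorm p μ f ≤ powNorm p μ g := by
  unfold powNorm
  gcongr with x
  exact h x

lemma powNorm_le_of_forall_min_natCast (hp : 0 < p) (hf : Measurable f) {A : ℝ≥0∞}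
    (hA : ∀ n : ℕ, powNorm p μ (fun x => min (f x) n) ≤ A) : powNorm p μ f ≤ A := by
  rw [powNorm_le_iff hp]
  refine lintegral_le_of_forall_tendsto (F := fun n x => min (f x) n ^ p) (fun n => by fun_prop)
    (fun x => ?_) (fun n => (powNorm_le_iff hp).1 (hA n))
  exact (ENNReal.continuous_rpow_const.tendsto _).comp (tendsto_min_natCast (f x))

lemma powNorm_const_mul (hp : 0 < p) {c : ℝ≥0∞} (hf : Measurable f) :
    powNorm p μ (fun x => c * f x) = c * powNorm p μ f := by
  unfold powNorm
  simp_rw [ENNReal.mul_rpow_of_nonneg _ _ hp.le]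
  rw [lintegral_const_mul _ (by fun_prop), ENNReal.mul_rpow_of_nonneg _ _ (by positivity),
    ← ENNReal.rpow_mul, mul_one_div_cancel hp.ne', ENNReal.rpow_one]

lemma powNorm_sum_le {ι : Type*} (s : Finset ι) {F : ι → α → ℝ≥0∞} (hp : 1 ≤ p)
    (hF : ∀ i, Measurable (F i)) :
    powNorm p μ (fun x => ∑ i ∈ s, F i x) ≤ ∑ i ∈ s, powNorm p μ (F i) := by
  classical
  induction s using Finset.induction_on with
  | empty =>
    have : (0 : ℝ) < p := by linarith
    simp [powNorm, this]
  | insert i s hi ih =>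
    simp only [Finset.sum_insert hi]
    exact (ENNReal.lintegral_Lp_add_le (hF i).aemeasurable
      (Finset.measurable_fun_sum s fun i _ => hF i).aemeasurable hp).trans (add_le_add le_rfl ih)

lemma lintegral_mul_le_powNorm (hpq : p.HolderConjugate q) (hf : Measurable f)
    (hg : Measurable g) : ∫⁻ x, f x * g x ∂μ ≤ powNorm p μ f * powNorm q μ g :=
  ENNReal.lintegral_mul_le_Lp_mul_Lq μ hpq hf.aemeasurable hg.aemeasurable

lemma powNorm_mul_le (hp : 0 < p) (hpq : p < q) (h : 1 / p = 1 / q + 1 / r) (hf : Measurable f)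
    (hg : Measurable g) : powNorm p μ (fun x => f x * g x) ≤ powNorm q μ f * powNorm r μ g :=
  ENNReal.lintegral_Lp_mul_le_Lq_mul_Lr hp hpq h μ hf.aemeasurable hg.aemeasurable

lemma eLpNorm_eq_powNorm {E : Type*} [ENorm E] (hp : 0 < p) (f : α → E) :
    eLpNorm f (ENNReal.ofReal p) μ = powNorm p μ (fun x => ‖f x‖ₑ) := by
  rw [eLpNorm_eq_lintegral_rpow_enorm_toReal (by simpa using hp) ENNReal.ofReal_ne_top,
    ENNReal.toReal_ofReal hp.le, powNorm]

lemma powNorm_le_mul_measure_univ (hp : 0 < p) (hpq : p ≤ q) (hf : Measurable f) :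
    powNorm p μ f ≤ powNorm q μ f * μ Set.univ ^ (1 / p - 1 / q) :=
  eLpNorm'_le_eLpNorm'_mul_rpow_measure_univ hp hpq hf.aestronglyMeasurable

lemma measurable_powNorm [SFinite μ] {f : β → α → ℝ≥0∞} (hf : Measurable (Function.uncurry f)) :
    Measurable fun y => powNorm p μ (f y) := by
  have : Measurable fun a : β × α => f a.1 a.2 ^ p := hf.pow_const p
  exact this.lintegral_prod_right'.pow_const _

/-- Converse of Hölder's inequality on a finite measure space. -/
lemma powNorm_le_of_forall_lintegral_mul_le [IsFiniteMeasure μ] (hpq : p.HolderConjugate q)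
    (hf : Measurable f) {A : ℝ≥0∞}
    (h : ∀ φ : α → ℝ≥0∞, Measurable φ → ∫⁻ x, φ x * f x ∂μ ≤ A * powNorm q μ φ) :
    powNorm p μ f ≤ A := by
  -- Truncation makes `I` finite on a finite measure space, so that `I ^ (1 / q)` can be cancelled
  -- at the end.
  refine powNorm_le_of_forall_min_natCast hpq.pos hf fun n => ?_
  set g : α → ℝ≥0∞ := fun x => min (f x) n with hg
  have hgm : Measurable g := by fun_prop
  set I := ∫⁻ x, g x ^ p ∂μ with hI
  have hp1 : 0 < p - 1 := hpq.sub_one_pos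
  have hIfin : I ≠ ∞ := by
    have : I ≤ ∫⁻ _, (n : ℝ≥0∞) ^ p ∂μ := by
      refine lintegral_mono fun x => ?_
      exact ENNReal.rpow_le_rpow (min_le_right _ _) hpq.nonneg
    refine (this.trans_lt ?_).ne
    rw [lintegral_const]
    exact ENNReal.mul_lt_top (ENNReal.rpow_lt_top_of_nonneg hpq.nonneg (by simp))
      (measure_lt_top _ _)
  -- The extremal test function is `φ = g ^ (p - 1)`, whose `q`-th power is `g ^ p`.
  have key : I ≤ A * I ^ (1 / q) := by
    have h1 : I ≤ ∫⁻ x, g x ^ (p - 1) * f x ∂μ := by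
      refine lintegral_mono fun x => ?_
      have : g x ^ p = g x ^ (p - 1) * g x := by
        conv_rhs => rw [← ENNReal.rpow_one (g x), ← ENNReal.rpow_mul, one_mul]
        rw [← ENNReal.rpow_add_of_nonneg _ _ hp1.le zero_le_one]
        simp
      simp only [this]
      gcongr
      exact min_le_left _ _
    refine h1.trans ((h _ (hgm.pow_const _)).trans ?_)
    rw [powNorm]
    simp_rw [← ENNReal.rpow_mul, hpq.sub_one_mul_conj]
    exact le_rfl
  rw [powNorm, ← hI]
  rcases eq_or_ne I 0 with h0 | h0
  · rw [h0, ENNReal.zero_rpow_of_pos (by have := hpq.pos; positivity)]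
    exact zero_le
  have hsum : 1 / p + 1 / q = 1 := by simpa using hpq.inv_add_inv_eq_one
  have h2 : I ^ (1 / p) * I ^ (1 / q) ≤ A * I ^ (1 / q) := by
    rwa [← ENNReal.rpow_add _ _ h0 hIfin, hsum, ENNReal.rpow_one]
  refine (ENNReal.mul_le_mul_iff_left ?_ ?_).1 h2
  · simp [h0, hIfin]
  · simp [h0, hIfin]

/-- Minkowski's integral inequality on a finite measure space. -/
lemma powNorm_lintegral_le [IsFiniteMeasure μ] [SFinite ν] (hpq : p.HolderConjugate q)
    {f : α → β → ℝ≥0∞} (hf : Measurable (Function.uncurry f)) :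
    powNorm p μ (fun x => ∫⁻ y, f x y ∂ν) ≤ ∫⁻ y, powNorm p μ (fun x => f x y) ∂ν := by
  refine powNorm_le_of_forall_lintegral_mul_le hpq hf.lintegral_prod_right' fun φ hφ => ?_
  have hf' : Measurable fun a : α × β => f a.1 a.2 := hf
  have hfy : ∀ y, Measurable fun x => f x y := fun y => hf'.comp measurable_prodMk_right
  have hfx : ∀ x, Measurable fun y => f x y := fun x => hf'.comp measurable_prodMk_left
  calc ∫⁻ x, φ x * ∫⁻ y, f x y ∂ν ∂μ = ∫⁻ x, ∫⁻ y, φ x * f x y ∂ν ∂μ := by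
        refine lintegral_congr fun x => ?_
        rw [lintegral_const_mul _ (hfx x)]
    _ = ∫⁻ y, ∫⁻ x, φ x * f x y ∂μ ∂ν := by
        refine lintegral_lintegral_swap (Measurable.aemeasurable ?_)
        exact (hφ.comp measurable_fst).mul hf'
    _ ≤ ∫⁻ y, powNorm p μ (fun x => f x y) * powNorm q μ φ ∂ν := by
        refine lintegral_mono fun y => ?_
        rw [mul_comm]
        exact lintegral_mul_le_powNorm hpq.symm hφ (hfy y)
    _ = _ := by
        rw [lintegral_mul_const]
        exact measurable_powNorm (f := fun y x => f x y) (hf'.comp measurable_swap)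

end PowNorm

/-! ### Cube-localized norms and Krylov's estimate in terms of them. -/

section CubeNorm

variable {d : ℕ}

/-- The space-time norm localized to unit cubes. -/
noncomputable def cubeNorm (p q : ℝ) (T : ℝ≥0) (f : ℝ≥0 → EuclideanSpace ℝ (Fin d) → ℝ≥0∞) :
    ℝ≥0∞ :=
  ⨆ z : EuclideanSpace ℝ (Fin d),
    powNorm q (timeMeasure T) fun t => powNorm p (volume.restrict (unitCube z)) (f t)

instance (T : ℝ≥0) : IsFiniteMeasure (timeMeasure T) := by
  unfold timeMeasure
  infer_instance

lemma timeMeasure_univ (T : ℝ≥0) : timeMeasure T Set.univ = T := by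
  rw [timeMeasure, Measure.map_apply (by fun_prop) MeasurableSet.univ]
  simp

lemma ae_timeMeasure_le (T : ℝ≥0) : ∀ᵐ t ∂(timeMeasure T), t ≤ T := by
  rw [timeMeasure, ae_map_iff (by fun_prop) measurableSet_Iic]
  filter_upwards [ae_restrict_mem measurableSet_Icc] with t ht
  exact Real.toNNReal_le_iff_le_coe.2 ht.2

lemma measurableSet_unitCube (z : EuclideanSpace ℝ (Fin d)) : MeasurableSet (unitCube z) := by
  have : unitCube z = ⋂ i, {x : EuclideanSpace ℝ (Fin d) | z i < x i ∧ x i ≤ z i + 1} := by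
    ext x; simp [unitCube]
  rw [this]
  refine MeasurableSet.iInter fun i => ?_
  have hi : Measurable fun x : EuclideanSpace ℝ (Fin d) => x i := by fun_prop
  exact hi measurableSet_Ioc

lemma volume_unitCube (z : EuclideanSpace ℝ (Fin d)) : volume (unitCube z) = 1 := by
  have : unitCube z = (MeasurableEquiv.toLp 2 (Fin d → ℝ)).symm ⁻¹'
      (Set.pi Set.univ fun i => Set.Ioc (z i) (z i + 1)) := by
    ext x; simp [unitCube, Set.mem_pi]
  rw [this, (EuclideanSpace.volume_preserving_symm_measurableEquiv_toLp (Fin d)).measure_preimage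
    (MeasurableSet.univ_pi fun i => measurableSet_Ioc).nullMeasurableSet, Real.volume_pi_Ioc]
  simp

instance (z : EuclideanSpace ℝ (Fin d)) :
    IsProbabilityMeasure ((volume : Measure (EuclideanSpace ℝ (Fin d))).restrict (unitCube z)) :=
  ⟨by rw [Measure.restrict_apply_univ, volume_unitCube]⟩

lemma powNorm_indicator {α : Type*} [MeasurableSpace α] {μ : Measure α} {p : ℝ} (hp : 0 < p)
    {s : Set α} (hs : MeasurableSet s) (f : α → ℝ≥0∞) :
    powNorm p μ (s.indicator f) = powNorm p (μ.restrict s) f := by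
  unfold powNorm
  rw [← lintegral_indicator hs]
  congr 2 with x
  by_cases hx : x ∈ s <;> simp [hx, hp]

lemma exists_mem_unitCube_add {R : ℝ} {z x : EuclideanSpace ℝ (Fin d)} (h : ‖x - z‖ ≤ R) :
    ∃ j ∈ Fintype.piFinset fun _ : Fin d => Finset.Icc (-(⌈R⌉ + 1)) (⌈R⌉ + 1),
      x ∈ unitCube (z + WithLp.toLp 2 fun i => (j i : ℝ)) := by
  -- The cubes are open on the left, so the offset is the ceiling minus one; this is why the index
  -- range extends one unit beyond `⌈R⌉`.
  refine ⟨fun i => ⌈x i - z i⌉ - 1, ?_, ?_⟩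
  · rw [Fintype.mem_piFinset]
    intro i
    have hi : |x i - z i| ≤ R := by
      have := PiLp.norm_apply_le (x - z) i
      simpa using this.trans h
    rw [abs_le] at hi
    rw [Finset.mem_Icc]
    have h1 : ⌈x i - z i⌉ ≤ ⌈R⌉ := Int.ceil_le_ceil hi.2
    have h2 : -⌈R⌉ ≤ ⌈x i - z i⌉ := by
      have : (-(⌈R⌉ : ℤ) : ℝ) ≤ ⌈x i - z i⌉ := by
        linarith [Int.le_ceil R, Int.le_ceil (x i - z i)]
      exact_mod_cast this
    omega
  · intro i
    have h1 := Int.le_ceil (x i - z i)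
    have h2 := Int.ceil_lt_add_one (x i - z i)
    simp only [PiLp.add_apply, Int.cast_sub, Int.cast_one]
    constructor <;> linarith

/-- The smoothly localized norm is controlled by the norm localized to unit cubes. -/
lemma exists_locNorm_le_cubeNorm {χ : EuclideanSpace ℝ (Fin d) → ℝ} (hχ : IsCutoff χ) {r : ℝ}
    (hr : 0 < r) :
    ∃ C : ℝ≥0, ∀ (p q : ℝ) (T : ℝ≥0) (f : ℝ≥0 → EuclideanSpace ℝ (Fin d) → ℝ), 1 ≤ p → 1 ≤ q →
      Measurable (Function.uncurry f) →
      locNorm χ r (ENNReal.ofReal p) (ENNReal.ofReal q) T f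
        ≤ C * cubeNorm p q T fun t x => ‖f t x‖ₑ := by
  obtain ⟨M, hM⟩ := hχ.hasCompactSupport.exists_bound_of_continuous hχ.contDiff.continuous
  -- Integer shifts whose cubes cover the ball of radius `2r` around `z`, which contains the support
  -- of the cut-off. Their number does not depend on `z`.
  set J := Fintype.piFinset fun _ : Fin d =>
    Finset.Icc (-(⌈2 * r⌉ + 1)) (⌈2 * r⌉ + 1) with hJ
  refine ⟨M.toNNReal * J.card, fun p q T f hp hq hf => ?_⟩
  have hp0 : 0 < p := by linarith
  have hq0 : 0 < q := by linarith
  have hf' : Measurable fun a : ℝ≥0 × EuclideanSpace ℝ (Fin d) => ‖f a.1 a.2‖ₑ := hf.enorm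
  have hft : ∀ t, Measurable fun x => ‖f t x‖ₑ := fun t => hf'.comp measurable_prodMk_left
  refine iSup_le fun z => ?_
  rw [eLpNorm_eq_powNorm hq0]
  simp only [enorm_eq_self, eLpNorm_eq_powNorm hp0]
  set c : (Fin d → ℤ) → EuclideanSpace ℝ (Fin d) := fun j =>
    z + WithLp.toLp 2 fun i => (j i : ℝ) with hc
  have hpt : ∀ t x, ‖cutoffAt χ r z x * f t x‖ₑ ≤
      (M.toNNReal : ℝ≥0∞) * ∑ j ∈ J, (unitCube (c j)).indicator (fun x => ‖f t x‖ₑ) x := by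
    intro t x
    by_cases hx : ‖x - z‖ ≤ 2 * r
    · obtain ⟨j, hj, hxj⟩ := exists_mem_unitCube_add hx
      rw [enorm_mul]
      gcongr
      · rw [← ofReal_norm]
        exact ENNReal.ofReal_le_ofReal (hM _)
      · refine le_trans ?_ (Finset.single_le_sum (f := fun j =>
          (unitCube (c j)).indicator (fun x => ‖f t x‖ₑ) x) (fun _ _ => zero_le) hj)
        rw [Set.indicator_of_mem hxj]
    · have : cutoffAt χ r z x = 0 := by
        refine hχ.eq_zero _ ?_
        rw [norm_smul, norm_inv, Real.norm_of_nonneg hr.le, lt_inv_mul_iff₀ hr]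
        linarith
      simp [this]
  have hin : ∀ t, powNorm p volume (fun x => ‖cutoffAt χ r z x * f t x‖ₑ) ≤
      (M.toNNReal : ℝ≥0∞) * ∑ j ∈ J,
        powNorm p (volume.restrict (unitCube (c j))) (fun x => ‖f t x‖ₑ) := by
    intro t
    have hm : ∀ j, Measurable ((unitCube (c j)).indicator fun x => ‖f t x‖ₑ) :=
      fun j => (hft t).indicator (measurableSet_unitCube _)
    refine (powNorm_mono hp0 (hpt t)).trans ?_
    rw [powNorm_const_mul hp0 (Finset.measurable_fun_sum J fun j _ => hm j)]
    gcongr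
    refine (powNorm_sum_le J hp hm).trans (le_of_eq ?_)
    exact Finset.sum_congr rfl fun j _ => powNorm_indicator hp0 (measurableSet_unitCube _) _
  have hmt : ∀ j, Measurable fun t =>
      powNorm p (volume.restrict (unitCube (c j))) (fun x => ‖f t x‖ₑ) :=
    fun j => measurable_powNorm hf'
  refine (powNorm_mono hq0 hin).trans ?_
  rw [powNorm_const_mul hq0 (Finset.measurable_fun_sum J fun j _ => hmt j)]
  push_cast
  rw [mul_assoc]
  gcongr
  refine (powNorm_sum_le J hq hmt).trans ?_
  rw [← nsmul_eq_mul]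
  refine Finset.sum_le_card_nsmul _ _ _ fun j _ => ?_
  exact le_iSup (fun z => powNorm q (timeMeasure T) fun t =>
    powNorm p (volume.restrict (unitCube z)) fun x => ‖f t x‖ₑ) (c j)

lemma cubeNorm_mono {p q : ℝ} (hp : 0 < p) (hq : 0 < q) {T : ℝ≥0}
    {f g : ℝ≥0 → EuclideanSpace ℝ (Fin d) → ℝ≥0∞} (h : ∀ t x, f t x ≤ g t x) :
    cubeNorm p q T f ≤ cubeNorm p q T g :=
  iSup_mono fun _ => powNorm_mono hq fun t => powNorm_mono hp (h t)

/-- Krylov's estimate for nonnegative functions, in terms of the norm localized to unit cubes. -/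
lemma exists_lintegral_le_cubeNorm {χ : EuclideanSpace ℝ (Fin d) → ℝ} (hχ : IsCutoff χ) {r : ℝ}
    (hr : 0 < r) (κ : ℝ≥0) :
    ∃ C : ℝ≥0, ∀ {Ω : Type*} [MeasurableSpace Ω] (P : Measure Ω) [IsProbabilityMeasure P]
      (p q : ℝ) (T : ℝ≥0) (X : ℝ≥0 → Ω → EuclideanSpace ℝ (Fin d)), 1 ≤ p → 1 ≤ q →
      Measurable (Function.uncurry X) →
      KrylovEstimate P χ r (ENNReal.ofReal p) (ENNReal.ofReal q) T κ X →
      ∀ f : ℝ≥0 → EuclideanSpace ℝ (Fin d) → ℝ≥0∞, Measurable (Function.uncurry f) →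
        ∫⁻ t, ∫⁻ ω, f t (X t ω) ∂P ∂(timeMeasure T) ≤ C * cubeNorm p q T f := by
  obtain ⟨C, hC⟩ := exists_locNorm_le_cubeNorm hχ hr
  -- Adding one keeps the constant positive, so the bound reads `∞` rather than `0 * ∞ = 0` when the
  -- norm of `f` is infinite.
  refine ⟨(κ + 1) * (C + 1), fun {Ω} _ P _ p q T X hp hq hX hK f hf => ?_⟩
  rcases eq_or_ne (cubeNorm p q T f) ∞ with htop | htop
  · rw [htop, ENNReal.mul_top]
    · exact le_top
    · exact_mod_cast (by positivity : (κ + 1) * (C + 1) ≠ 0)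
  have hf' : Measurable fun a : ℝ≥0 × EuclideanSpace ℝ (Fin d) => f a.1 a.2 := hf
  have hX' : Measurable fun a : ℝ≥0 × Ω => X a.1 a.2 := hX
  have hfX : Measurable fun a : ℝ≥0 × Ω => f a.1 (X a.1 a.2) :=
    hf'.comp (measurable_fst.prodMk hX')
  rw [← lintegral_prod (fun a : ℝ≥0 × Ω => f a.1 (X a.1 a.2)) hfX.aemeasurable]
  -- Krylov's estimate is given for real-valued functions only; truncations of `f` are finite and
  -- have no larger norm.
  refine lintegral_le_of_forall_tendsto (F := fun n a => min (f a.1 (X a.1 a.2)) n)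
    (fun n => by fun_prop) (fun a => tendsto_min_natCast _) fun n => ?_
  set g : ℝ≥0 → EuclideanSpace ℝ (Fin d) → ℝ := fun t x => (min (f t x) n).toReal with hg
  have hge : ∀ t x, ‖g t x‖ₑ = min (f t x) n := by
    intro t x
    rw [Real.enorm_of_nonneg ENNReal.toReal_nonneg, ENNReal.ofReal_toReal]
    exact ((min_le_right _ _).trans_lt (by simp)).ne
  have hgm : Measurable (Function.uncurry g) := (hf'.min measurable_const).ennreal_toReal
  have hgn : locNorm χ r (ENNReal.ofReal p) (ENNReal.ofReal q) T g ≤ C * cubeNorm p q T f := by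
    refine (hC p q T g hp hq hgm).trans ?_
    gcongr
    refine cubeNorm_mono (by linarith) (by linarith) fun t x => ?_
    rw [hge]
    exact min_le_left _ _
  have hkey := hK g ⟨hgm, hgn.trans_lt (ENNReal.mul_lt_top (by simp) htop.lt_top)⟩
  simp only [hge] at hkey
  have hm : Measurable fun a : ℝ≥0 × Ω => min (f a.1 (X a.1 a.2)) n := by fun_prop
  rw [lintegral_prod_symm _ hm.aemeasurable]
  refine hkey.trans ?_
  push_cast
  rw [mul_assoc]
  gcongr
  · exact le_self_add
  · refine hgn.trans ?_
    gcongr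
    exact le_self_add

end CubeNorm

/-! ### Joint laws with an independent copy and the Krylov estimate for pairs. -/

section JointLaw

variable {d : ℕ} {Ω : Type*} [MeasurableSpace Ω] {P : Measure Ω}

/-- The mixed space-time norm localized to products of unit cubes. -/
noncomputable def cubeMixedNorm (p₁ p₂ q : ℝ) (T : ℝ≥0)
    (g : ℝ≥0 → EuclideanSpace ℝ (Fin d) → EuclideanSpace ℝ (Fin d) → ℝ≥0∞) : ℝ≥0∞ :=
  ⨆ (z : EuclideanSpace ℝ (Fin d)) (z' : EuclideanSpace ℝ (Fin d)),
    powNorm q (timeMeasure T) fun t =>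
      powNorm p₂ (volume.restrict (unitCube z')) fun y =>
        powNorm p₁ (volume.restrict (unitCube z)) fun x => g t x y

lemma locMixedNorm_eq_cubeMixedNorm {F : Type*} [NormedAddCommGroup F] {p₁ p₂ q : ℝ}
    (hp₁ : 0 < p₁) (hp₂ : 0 < p₂) (hq : 0 < q) (T : ℝ≥0)
    (f : ℝ≥0 → EuclideanSpace ℝ (Fin d) → EuclideanSpace ℝ (Fin d) → F) :
    locMixedNorm (ENNReal.ofReal p₁) (ENNReal.ofReal p₂) (ENNReal.ofReal q) T f =
      cubeMixedNorm p₁ p₂ q T fun t x y => ‖f t x y‖ₑ := by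
  simp only [locMixedNorm, cubeMixedNorm, eLpNorm_eq_powNorm hp₁, eLpNorm_eq_powNorm hp₂,
    eLpNorm_eq_powNorm hq, enorm_eq_self]

lemma powNorm_rpow_left {α : Type*} [MeasurableSpace α] {μ : Measure α} {γ : ℝ} (hγ : 0 < γ)
    (p : ℝ) (f : α → ℝ≥0∞) : powNorm p μ (fun x => f x ^ γ) = powNorm (γ * p) μ f ^ γ := by
  unfold powNorm
  simp_rw [← ENNReal.rpow_mul]
  congr 1
  rw [one_div, one_div, mul_inv, mul_right_comm, inv_mul_cancel₀ hγ.ne', one_mul]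

/-- A power `γ` passes through each nested norm by multiplying its exponent by `γ`. This converts
the assumption on `b̄` into a bound on its `γ`-moments. -/
lemma cubeMixedNorm_rpow {γ : ℝ} (hγ : 0 < γ) (p₁ p₂ q : ℝ) (T : ℝ≥0)
    (g : ℝ≥0 → EuclideanSpace ℝ (Fin d) → EuclideanSpace ℝ (Fin d) → ℝ≥0∞) :
    cubeMixedNorm p₁ p₂ q T (fun t x y => g t x y ^ γ) ≤
      cubeMixedNorm (γ * p₁) (γ * p₂) (γ * q) T g ^ γ := by
  refine iSup₂_le fun z z' => ?_
  simp only [powNorm_rpow_left hγ]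
  gcongr
  exact le_iSup₂ (f := fun z z' => powNorm (γ * q) (timeMeasure T) fun t =>
      powNorm (γ * p₂) (volume.restrict (unitCube z')) fun y =>
        powNorm (γ * p₁) (volume.restrict (unitCube z)) fun x => g t x y) z z'

/-- The Krylov estimates for two independent processes combine to an estimate for the pair. -/
lemma lintegral_pair_le_cubeMixedNorm [IsProbabilityMeasure P] {p₁ p₂ q₀ q₁ q₂ : ℝ}
    (hp₁ : 1 < p₁) (hp₂ : 0 < p₂) (hq₀ : 1 < q₀) (hq₁ : 1 < q₁) (hq₂ : 1 < q₂)
    (hq : 1 / q₁ + 1 / q₂ = 1 + 1 / q₀) {T : ℝ≥0} {A B : ℝ≥0∞}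
    {X Y : ℝ≥0 → Ω → EuclideanSpace ℝ (Fin d)}
    (hY : Measurable (Function.uncurry Y))
    (hXK : ∀ f : ℝ≥0 → EuclideanSpace ℝ (Fin d) → ℝ≥0∞, Measurable (Function.uncurry f) →
      ∫⁻ t, ∫⁻ ω, f t (X t ω) ∂P ∂(timeMeasure T) ≤ A * cubeNorm p₁ q₁ T f)
    (hYK : ∀ f : ℝ≥0 → EuclideanSpace ℝ (Fin d) → ℝ≥0∞, Measurable (Function.uncurry f) →
      ∫⁻ t, ∫⁻ ω, f t (Y t ω) ∂P ∂(timeMeasure T) ≤ B * cubeNorm p₂ q₂ T f)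
    {g : ℝ≥0 → EuclideanSpace ℝ (Fin d) → EuclideanSpace ℝ (Fin d) → ℝ≥0∞}
    (hg : Measurable fun a : ℝ≥0 × EuclideanSpace ℝ (Fin d) × EuclideanSpace ℝ (Fin d) =>
      g a.1 a.2.1 a.2.2) :
    ∫⁻ t, ∫⁻ ω, ∫⁻ ω', g t (X t ω) (Y t ω') ∂P ∂P ∂(timeMeasure T) ≤
      A * B * cubeMixedNorm p₁ p₂ q₀ T g := by
  have hY' : Measurable fun a : ℝ≥0 × Ω => Y a.1 a.2 := hY
  have hgY : Measurable fun a : (ℝ≥0 × EuclideanSpace ℝ (Fin d)) × Ω =>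
      g a.1.1 a.1.2 (Y a.1.1 a.2) :=
    hg.comp ((measurable_fst.fst).prodMk ((measurable_fst.snd).prodMk
      (hY'.comp ((measurable_fst.fst).prodMk measurable_snd))))
  refine (hXK (fun t x => ∫⁻ ω', g t x (Y t ω') ∂P) hgY.lintegral_prod_right').trans ?_
  rw [mul_assoc]
  gcongr
  refine iSup_le fun z => ?_
  set h : ℝ≥0 → EuclideanSpace ℝ (Fin d) → ℝ≥0∞ := fun t y =>
    powNorm p₁ (volume.restrict (unitCube z)) fun x => g t x y with hh
  have hhm : Measurable fun a : ℝ≥0 × EuclideanSpace ℝ (Fin d) => h a.1 a.2 := by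
    refine measurable_powNorm (f := fun (a : ℝ≥0 × EuclideanSpace ℝ (Fin d)) x => g a.1 x a.2) ?_
    exact hg.comp ((measurable_fst.fst).prodMk (measurable_snd.prodMk measurable_fst.snd))
  have hhY : Measurable fun a : ℝ≥0 × Ω => h a.1 (Y a.1 a.2) :=
    hhm.comp (measurable_fst.prodMk hY')
  have hinner : ∀ t, powNorm p₁ (volume.restrict (unitCube z))
      (fun x => ∫⁻ ω', g t x (Y t ω') ∂P) ≤ ∫⁻ ω', h t (Y t ω') ∂P := fun t =>
    powNorm_lintegral_le (Real.HolderConjugate.conjExponent hp₁) (f := fun x ω' => g t x (Y t ω'))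
      (hgY.comp ((measurable_const.prodMk measurable_fst).prodMk measurable_snd))
  have hconj := Real.HolderConjugate.conjExponent hq₁
  refine (powNorm_mono (by linarith) hinner).trans ?_
  -- Duality in time: with the weight `φ`, the left side becomes a space-time expectation along `Y`,
  -- to which Krylov's estimate for `Y` applies.
  refine powNorm_le_of_forall_lintegral_mul_le hconj hhY.lintegral_prod_right' fun φ hφ => ?_
  -- The hypothesis on the time exponents, rewritten as the Hölder relation that places `φ` in
  -- `L^{q₁'}` and the kernel in `L^{q₀}`.
  have hexp : 1 / q₂ = 1 / q₁.conjExponent + 1 / q₀ := by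
    have := hconj.inv_add_inv_eq_one
    simp only [one_div] at *
    linarith
  have hlt : q₂ < q₁.conjExponent := by
    have h0 : 0 < 1 / q₀ := by positivity
    have : 1 / q₁.conjExponent < 1 / q₂ := by linarith
    exact (one_div_lt_one_div hconj.symm.pos (by linarith)).1 this
  have hφY : ∀ t, φ t * ∫⁻ ω', h t (Y t ω') ∂P = ∫⁻ ω', φ t * h t (Y t ω') ∂P := fun t =>
    (lintegral_const_mul _ (hhY.comp measurable_prodMk_left)).symm
  simp only [hφY]
  refine (hYK (fun t y => φ t * h t y) ((hφ.comp measurable_fst).mul hhm)).trans ?_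
  rw [mul_assoc]
  gcongr
  refine iSup_le fun z' => ?_
  have hhy : ∀ t, Measurable fun y => h t y := fun t => hhm.comp measurable_prodMk_left
  simp only [powNorm_const_mul hp₂ (hhy _)]
  refine (powNorm_mul_le (by linarith) hlt hexp hφ (measurable_powNorm hhm)).trans ?_
  rw [mul_comm]
  gcongr
  exact le_iSup₂ (f := fun z z' => powNorm q₀ (timeMeasure T) fun t =>
      powNorm p₂ (volume.restrict (unitCube z')) fun y =>
        powNorm p₁ (volume.restrict (unitCube z)) fun x => g t x y) z z'

/-- The law of `(t, X t, Y' t)` under the product of Lebesgue measure on `[0, T]` and `P ⊗ P`,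
with `Y'` an independent copy of `Y`. -/
noncomputable def jointLaw (P : Measure Ω) (T : ℝ≥0) (X Y : ℝ≥0 → Ω → EuclideanSpace ℝ (Fin d)) :
    Measure (ℝ≥0 × EuclideanSpace ℝ (Fin d) × EuclideanSpace ℝ (Fin d)) :=
  ((timeMeasure T).prod (P.prod P)).map fun a => (a.1, X a.1 a.2.1, Y a.1 a.2.2)

lemma measurable_jointMap {X Y : ℝ≥0 → Ω → EuclideanSpace ℝ (Fin d)}
    (hX : Measurable (Function.uncurry X)) (hY : Measurable (Function.uncurry Y)) :
    Measurable fun a : ℝ≥0 × Ω × Ω => (a.1, X a.1 a.2.1, Y a.1 a.2.2) := by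
  have hX' : Measurable fun a : ℝ≥0 × Ω => X a.1 a.2 := hX
  have hY' : Measurable fun a : ℝ≥0 × Ω => Y a.1 a.2 := hY
  exact measurable_fst.prodMk ((hX'.comp (measurable_fst.prodMk measurable_snd.fst)).prodMk
    (hY'.comp (measurable_fst.prodMk measurable_snd.snd)))

instance [IsFiniteMeasure P] (T : ℝ≥0) (X Y : ℝ≥0 → Ω → EuclideanSpace ℝ (Fin d)) :
    IsFiniteMeasure (jointLaw P T X Y) := by
  unfold jointLaw
  infer_instance

lemma jointLaw_univ [IsProbabilityMeasure P] {T : ℝ≥0}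
    {X Y : ℝ≥0 → Ω → EuclideanSpace ℝ (Fin d)}
    (hX : Measurable (Function.uncurry X)) (hY : Measurable (Function.uncurry Y)) :
    jointLaw P T X Y Set.univ = T := by
  rw [jointLaw, Measure.map_apply (measurable_jointMap hX hY) MeasurableSet.univ,
    Set.preimage_univ, ← Set.univ_prod_univ, Measure.prod_prod, timeMeasure_univ,
    measure_univ, mul_one]

lemma lintegral_jointLaw [IsProbabilityMeasure P] {T : ℝ≥0}
    {X Y : ℝ≥0 → Ω → EuclideanSpace ℝ (Fin d)}
    (hX : Measurable (Function.uncurry X)) (hY : Measurable (Function.uncurry Y))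
    {g : ℝ≥0 × EuclideanSpace ℝ (Fin d) × EuclideanSpace ℝ (Fin d) → ℝ≥0∞} (hg : Measurable g) :
    ∫⁻ a, g a ∂(jointLaw P T X Y) =
      ∫⁻ t, ∫⁻ ω, ∫⁻ ω', g (t, X t ω, Y t ω') ∂P ∂P ∂(timeMeasure T) := by
  have hm := measurable_jointMap hX hY
  have hgm : Measurable fun a : ℝ≥0 × Ω × Ω => g (a.1, X a.1 a.2.1, Y a.1 a.2.2) := hg.comp hm
  rw [jointLaw, lintegral_map hg hm, lintegral_prod _ hgm.aemeasurable]
  refine lintegral_congr fun t => ?_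
  rw [lintegral_prod]
  exact (hgm.comp measurable_prodMk_left).aemeasurable

/-- On a product of unit cubes the mixed norm is controlled by a single `L^p` norm. -/
lemma cubeMixedNorm_le_powNorm {p₁ p₂ q p : ℝ} (hp₁ : 0 < p₁) (hp₂ : 0 < p₂) (hq : 0 < q)
    (h₁ : p₁ ≤ p) (h₂ : p₂ ≤ p) (h : q ≤ p) (T : ℝ≥0)
    {g : ℝ≥0 × EuclideanSpace ℝ (Fin d) × EuclideanSpace ℝ (Fin d) → ℝ≥0∞} (hg : Measurable g) :
    cubeMixedNorm p₁ p₂ q T (fun t x y => g (t, x, y)) ≤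
      powNorm p ((timeMeasure T).prod (volume.prod volume)) g * (T : ℝ≥0∞) ^ (1 / q - 1 / p) := by
  have hp : 0 < p := by linarith
  refine iSup₂_le fun z z' => ?_
  have hgx : ∀ t y, Measurable fun x => g (t, x, y) := fun t y =>
    hg.comp (measurable_const.prodMk (measurable_id.prodMk measurable_const))
  have hgs : Measurable fun a : (ℝ≥0 × EuclideanSpace ℝ (Fin d)) × EuclideanSpace ℝ (Fin d) =>
      g (a.1.1, a.2, a.1.2) :=
    hg.comp (measurable_fst.fst.prodMk (measurable_snd.prodMk measurable_fst.snd))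
  have hi1 : ∀ p', Measurable fun a : ℝ≥0 × EuclideanSpace ℝ (Fin d) =>
      powNorm p' (volume.restrict (unitCube z)) fun x => g (a.1, x, a.2) := fun p' =>
    measurable_powNorm (f := fun (a : ℝ≥0 × EuclideanSpace ℝ (Fin d)) x => g (a.1, x, a.2)) hgs
  have hi2 : ∀ p' p'', Measurable fun t => powNorm p' (volume.restrict (unitCube z')) fun y =>
      powNorm p'' (volume.restrict (unitCube z)) fun x => g (t, x, y) := fun p' p'' =>
    measurable_powNorm (hi1 p'')
  -- Raising the space exponents to `p` is free because unit cubes have volume one; raising the time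
  -- exponent costs a power of `T`. With all exponents equal, Tonelli gives one integral, and the
  -- cubes can be dropped.
  calc _ ≤ powNorm q (timeMeasure T) fun t => powNorm p (volume.restrict (unitCube z')) fun y =>
        powNorm p (volume.restrict (unitCube z)) fun x => g (t, x, y) := by
        refine powNorm_mono hq fun t => ?_
        have hy := powNorm_le_mul_measure_univ (μ := volume.restrict (unitCube z')) hp₂ h₂
          ((hi1 p).comp (measurable_prodMk_left (x := t)))
        have hx := fun y => powNorm_le_mul_measure_univ (μ := volume.restrict (unitCube z)) hp₁ h₁
          (hgx t y)
        simp only [measure_univ, ENNReal.one_rpow, mul_one] at hx hy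
        exact (powNorm_mono hp₂ hx).trans hy
    _ ≤ powNorm p (timeMeasure T) (fun t => powNorm p (volume.restrict (unitCube z')) fun y =>
        powNorm p (volume.restrict (unitCube z)) fun x => g (t, x, y)) *
          (T : ℝ≥0∞) ^ (1 / q - 1 / p) := by
        rw [← timeMeasure_univ T]
        exact powNorm_le_mul_measure_univ hq h (hi2 p p)
    _ ≤ _ := by
        gcongr
        rw [powNorm_le_iff hp]
        simp only [powNorm_rpow hp]
        rw [lintegral_prod _ (hg.pow_const p).aemeasurable]
        refine lintegral_mono fun t => ?_
        have hgt : Measurable fun a : EuclideanSpace ℝ (Fin d) × EuclideanSpace ℝ (Fin d) =>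
            g (t, a) ^ p := (hg.comp measurable_prodMk_left).pow_const p
        rw [lintegral_prod_symm _ hgt.aemeasurable]
        refine (lintegral_mono' Measure.restrict_le_self fun y => ?_)
        exact lintegral_mono' Measure.restrict_le_self le_rfl

end JointLaw

/-! ### Convergence for continuous kernels with compact support. -/

section WeakConvergence

variable {d : ℕ} {Ω : Type*} [MeasurableSpace Ω] {P : Measure Ω} [IsProbabilityMeasure P]
  {G : Type*} [NormedAddCommGroup G] [NormedSpace ℝ G]

/-- Writing the integral against the law as an expectation over an independent copy makes it a
parameter integral over the fixed measure `P`. -/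
lemma stronglyMeasurable_integral_map {X Y : ℝ≥0 → Ω → EuclideanSpace ℝ (Fin d)}
    (hX : Measurable (Function.uncurry X)) (hY : Measurable (Function.uncurry Y))
    {h : ℝ≥0 × EuclideanSpace ℝ (Fin d) × EuclideanSpace ℝ (Fin d) → G}
    (hh : StronglyMeasurable h) :
    StronglyMeasurable fun a : ℝ≥0 × Ω => ∫ y, h (a.1, X a.1 a.2, y) ∂(P.map (Y a.1)) := by
  have hX' : Measurable fun a : ℝ≥0 × Ω => X a.1 a.2 := hX
  have hY' : Measurable fun a : ℝ≥0 × Ω => Y a.1 a.2 := hY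
  have heq : ∀ a : ℝ≥0 × Ω, ∫ y, h (a.1, X a.1 a.2, y) ∂(P.map (Y a.1)) =
      ∫ ω', h (a.1, X a.1 a.2, Y a.1 ω') ∂P := fun a =>
    integral_map (hY'.comp measurable_prodMk_left).aemeasurable
      (hh.comp_measurable (measurable_const.prodMk
        (measurable_const.prodMk measurable_id))).aestronglyMeasurable
  simp only [heq]
  refine StronglyMeasurable.integral_prod_right'
    (f := fun b : (ℝ≥0 × Ω) × Ω => h (b.1.1, X b.1.1 b.1.2, Y b.1.1 b.2)) ?_
  exact hh.comp_measurable (measurable_fst.fst.prodMk ((hX'.comp measurable_fst).prodMk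
    (hY'.comp (measurable_fst.fst.prodMk measurable_snd))))

variable [FiniteDimensional ℝ G]

lemma tendsto_integral_map_of_tendstoInDistribution {E : Type*} [TopologicalSpace E]
    [MeasurableSpace E] [OpensMeasurableSpace E] {Yn : ℕ → Ω → E} {Y : Ω → E}
    (h : TendstoInDistribution Yn atTop Y (fun _ => P) P) {c : E → G} (hc : Continuous c)
    (hcm : StronglyMeasurable c) {M : ℝ} (hM : ∀ y, ‖c y‖ ≤ M) :
    Tendsto (fun n => ∫ y, c y ∂(P.map (Yn n))) atTop (𝓝 (∫ y, c y ∂(P.map Y))) := by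
  have : CompleteSpace G := FiniteDimensional.complete ℝ G
  have hint : ∀ Z : Ω → E, Integrable c (P.map Z) := fun Z =>
    Integrable.of_bound hcm.aestronglyMeasurable M (Eventually.of_forall hM)
  -- Weak convergence tests real-valued functions, so the vector-valued integral is treated
  -- coordinate by coordinate.
  set e := (Module.finBasis ℝ G).equivFunL
  have hcoord : ∀ (Z : Ω → E) i, e (∫ y, c y ∂(P.map Z)) i = ∫ y, e (c y) i ∂(P.map Z) :=
    fun Z i => (((ContinuousLinearMap.proj i).comp e.toContinuousLinearMap).integral_comp_comm
      (hint Z)).symm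
  have hlim : Tendsto (fun n => e (∫ y, c y ∂(P.map (Yn n)))) atTop
      (𝓝 (e (∫ y, c y ∂(P.map Y)))) := by
    refine tendsto_pi_nhds.2 fun i => ?_
    simp only [hcoord]
    have hci : Continuous fun y => e (c y) i :=
      (continuous_apply i).comp (e.continuous.comp hc)
    exact (ProbabilityMeasure.tendsto_iff_forall_integral_tendsto.1 h.tendsto)
      (BoundedContinuousFunction.ofNormedAddCommGroup (fun y => e (c y) i) hci
        (‖e.toContinuousLinearMap‖ * M) fun y =>
          (norm_le_pi_norm (e (c y)) i).trans
            ((e.toContinuousLinearMap.le_opNorm (c y)).trans (by gcongr; exact hM y)))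
  simpa [Function.comp_def] using (e.symm.continuous.tendsto _).comp hlim

/-- With the point frozen at `x` this is weak convergence. Moving it to `xn n` changes the integrand
uniformly little in `y`, since `c` is uniformly continuous and the laws have mass one. -/
lemma tendsto_integral_map_of_hasCompactSupport {A E E' : Type*} [PseudoMetricSpace A]
    [PseudoMetricSpace E] [PseudoMetricSpace E'] [SecondCountableTopology E']
    [MeasurableSpace E'] [BorelSpace E'] {Yn : ℕ → Ω → E'} {Y : Ω → E'}
    (h : TendstoInDistribution Yn atTop Y (fun _ => P) P) {xn : ℕ → E} {x : E}
    (hx : Tendsto xn atTop (𝓝 x)) {c : A × E × E' → G} (hc : Continuous c)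
    (hcs : HasCompactSupport c) (t : A) :
    Tendsto (fun n => ∫ y, c (t, xn n, y) ∂(P.map (Yn n))) atTop
      (𝓝 (∫ y, c (t, x, y) ∂(P.map Y))) := by
  obtain ⟨M, hM⟩ := hcs.exists_bound_of_continuous hc
  have hcy : ∀ x, Continuous fun y => c (t, x, y) := fun x => by fun_prop
  have hint : ∀ x (Z : Ω → E'), Integrable (fun y => c (t, x, y)) (P.map Z) := fun x Z =>
    Integrable.of_bound (hcy x).stronglyMeasurable.aestronglyMeasurable M
      (Eventually.of_forall fun y => hM _)
  have h1 := tendsto_integral_map_of_tendstoInDistribution h (hcy x) (hcy x).stronglyMeasurable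
    (fun y => hM _)
  have h2 : Tendsto (fun n => ∫ y, c (t, xn n, y) ∂(P.map (Yn n)) -
      ∫ y, c (t, x, y) ∂(P.map (Yn n))) atTop (𝓝 0) := by
    rw [Metric.tendsto_atTop]
    intro ε hε
    obtain ⟨δ, hδ, hu⟩ := Metric.uniformContinuous_iff.1
      (hcs.uniformContinuous_of_continuous hc) (ε / 2) (by positivity)
    obtain ⟨N, hN⟩ := Metric.tendsto_atTop.1 hx δ hδ
    refine ⟨N, fun n hn => ?_⟩
    rw [dist_zero_right, ← integral_sub (hint _ _) (hint _ _)]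
    have := Measure.isProbabilityMeasure_map (h.forall_aemeasurable n)
    refine (norm_integral_le_of_norm_le_const (C := ε / 2)
      (Eventually.of_forall fun y => ?_)).trans_lt ?_
    · rw [← dist_eq_norm]
      refine (hu ?_).le
      simpa [Prod.dist_eq, hδ] using hN n hn
    · simp [hε]
  simpa using h2.add h1

/-- For continuous kernels with compact support, mean-field drifts along converging processes
converge in `L^1`. -/
lemma tendsto_lintegral_enorm_sub_of_hasCompactSupport {T : ℝ≥0}
    {Xn Yn : ℕ → ℝ≥0 → Ω → EuclideanSpace ℝ (Fin d)} {X Y : ℝ≥0 → Ω → EuclideanSpace ℝ (Fin d)}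
    (hXn : ∀ n, Measurable (Function.uncurry (Xn n)))
    (hYn : ∀ n, Measurable (Function.uncurry (Yn n)))
    (hX : Measurable (Function.uncurry X)) (hY : Measurable (Function.uncurry Y))
    (hXconv : ∀ t, ∀ᵐ ω ∂P, Tendsto (fun n => Xn n t ω) atTop (𝓝 (X t ω)))
    (hYconv : ∀ t, TendstoInDistribution (fun n => Yn n t) atTop (Y t) (fun _ => P) P)
    {c : ℝ≥0 × EuclideanSpace ℝ (Fin d) × EuclideanSpace ℝ (Fin d) → G} (hc : Continuous c)
    (hcs : HasCompactSupport c) :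
    Tendsto (fun n => ∫⁻ t, ∫⁻ ω, ‖∫ y, c (t, Xn n t ω, y) ∂(P.map (Yn n t)) -
      ∫ y, c (t, X t ω, y) ∂(P.map (Y t))‖ₑ ∂P ∂(timeMeasure T)) atTop (𝓝 0) := by
  obtain ⟨M, hM⟩ := hcs.exists_bound_of_continuous hc
  have hb : ∀ (Z : ℝ≥0 → Ω → EuclideanSpace ℝ (Fin d)), Measurable (Function.uncurry Z) →
      ∀ t x, ‖∫ y, c (t, x, y) ∂(P.map (Z t))‖ ≤ M := by
    intro Z hZ t x
    have hZt : Measurable (Z t) := hZ.comp measurable_prodMk_left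
    have := Measure.isProbabilityMeasure_map (μ := P) hZt.aemeasurable
    refine (norm_integral_le_of_norm_le_const (Eventually.of_forall fun y => hM _)).trans_eq ?_
    simp
  set D : ℕ → ℝ≥0 × Ω → ℝ≥0∞ := fun n a => ‖∫ y, c (a.1, Xn n a.1 a.2, y) ∂(P.map (Yn n a.1)) -
      ∫ y, c (a.1, X a.1 a.2, y) ∂(P.map (Y a.1))‖ₑ with hD
  have hDm : ∀ n, Measurable (D n) := fun n =>
    ((stronglyMeasurable_integral_map (hXn n) (hYn n) hc.stronglyMeasurable).sub
      (stronglyMeasurable_integral_map hX hY hc.stronglyMeasurable)).enorm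
  have hDb : ∀ n a, D n a ≤ ENNReal.ofReal (M + M) := by
    intro n a
    simp only [hD]
    rw [← ofReal_norm]
    exact ENNReal.ofReal_le_ofReal ((norm_sub_le _ _).trans
      (add_le_add (hb _ (hYn n) _ _) (hb _ hY _ _)))
  have hinner : ∀ t, Tendsto (fun n => ∫⁻ ω, D n (t, ω) ∂P) atTop (𝓝 0) := by
    intro t
    rw [← lintegral_zero (μ := P)]
    refine tendsto_lintegral_of_dominated_convergence (fun _ => ENNReal.ofReal (M + M))
      (fun n => (hDm n).comp measurable_prodMk_left)
      (fun n => Eventually.of_forall fun ω => hDb n _) (by simp) ?_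
    filter_upwards [hXconv t] with ω hω
    have h := tendsto_integral_map_of_hasCompactSupport (hYconv t) hω hc hcs t
    have h' := (tendsto_iff_norm_sub_tendsto_zero.1 h)
    have h'' := ENNReal.tendsto_ofReal h'
    simpa only [ofReal_norm, ENNReal.ofReal_zero] using h''
  rw [← lintegral_zero (μ := timeMeasure T)]
  refine tendsto_lintegral_of_dominated_convergence (fun _ => ENNReal.ofReal (M + M))
    (fun n => (hDm n).lintegral_prod_right') (fun n => Eventually.of_forall fun t => ?_)
    (by simp [ENNReal.mul_eq_top]) (Eventually.of_forall hinner)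
  exact (lintegral_mono fun ω => hDb n (t, ω)).trans (by simp)

end WeakConvergence

/-! ### Transfer of bounds to the limit law, and uniform approximation of kernels. -/

section Approximation

lemma ENNReal.le_of_forall_le_add_mul {a b D : ℝ≥0∞} (hD : D ≠ ∞)
    (h : ∀ δ : ℝ≥0∞, δ ≠ 0 → a ≤ b + δ * D) : a ≤ b := by
  have h1 : Tendsto (fun n : ℕ => b + ((n : ℝ≥0∞)⁻¹) * D) atTop (𝓝 (b + 0 * D)) :=
    tendsto_const_nhds.add
      (ENNReal.Tendsto.mul_const ENNReal.tendsto_inv_nat_nhds_zero (Or.inr hD))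
  rw [zero_mul, add_zero] at h1
  exact ge_of_tendsto' h1 fun n => h _ (by simp)

lemma exists_nat_rpow_neg_mul_le {a : ℝ} (ha : 0 < a) {K ε : ℝ≥0∞} (hK : K ≠ ∞) (hε : ε ≠ 0) :
    ∃ n : ℕ, 0 < n ∧ (n : ℝ≥0∞) ^ (-a) * K ≤ ε := by
  have h1 : Tendsto (fun n : ℕ => (n : ℝ≥0∞) ^ (-a) * K) atTop (𝓝 (∞ ^ (-a) * K)) :=
    ENNReal.Tendsto.mul_const
      ((ENNReal.continuous_rpow_const.tendsto _).comp ENNReal.tendsto_nat_nhds_top) (Or.inr hK)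
  rw [ENNReal.top_rpow_of_neg (by linarith), zero_mul] at h1
  obtain ⟨n, hn, hn'⟩ := ((ENNReal.tendsto_nhds_zero.1 h1 ε (pos_iff_ne_zero.2 hε)).and
    (eventually_gt_atTop 0)).exists
  exact ⟨n, hn', hn⟩

/-- The pointwise form of Chebyshev's inequality: inserting this factor on a tail set bounds the
tail by a moment with a small coefficient. -/
lemma one_le_rpow_neg_mul_rpow {a : ℝ} (ha : 0 ≤ a) {n : ℕ} (hn : 0 < n) {u : ℝ≥0∞}
    (hu : (n : ℝ≥0∞) ≤ u) : 1 ≤ (n : ℝ≥0∞) ^ (-a) * u ^ a := by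
  calc (1 : ℝ≥0∞) = (n : ℝ≥0∞) ^ (-a) * (n : ℝ≥0∞) ^ a := by
        rw [← ENNReal.rpow_add _ _ (by exact_mod_cast hn.ne') (by simp)]
        simp
    _ ≤ _ := by gcongr

variable {d : ℕ}

/-- The reference measure `dt ⊗ dx ⊗ dy` on `[0, T] × ℝ^d × ℝ^d`. -/
noncomputable def refMeasure (d : ℕ) (T : ℝ≥0) :
    Measure (ℝ≥0 × EuclideanSpace ℝ (Fin d) × EuclideanSpace ℝ (Fin d)) :=
  (timeMeasure T).prod (volume.prod volume)

instance (T : ℝ≥0) : IsLocallyFiniteMeasure (refMeasure d T) := by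
  unfold refMeasure
  infer_instance

/-- The set of points `(t, x, y)` with `|x|, |y| ≤ R`. -/
def spaceBox (d : ℕ) (R : ℝ) :
    Set (ℝ≥0 × EuclideanSpace ℝ (Fin d) × EuclideanSpace ℝ (Fin d)) :=
  Set.univ ×ˢ (Metric.closedBall 0 R ×ˢ Metric.closedBall 0 R)

lemma measurableSet_spaceBox (R : ℝ) : MeasurableSet (spaceBox d R) :=
  MeasurableSet.univ.prod (measurableSet_closedBall.prod measurableSet_closedBall)

lemma refMeasure_spaceBox_lt_top (T : ℝ≥0) (R : ℝ) : refMeasure d T (spaceBox d R) < ∞ := by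
  rw [refMeasure, spaceBox, Measure.prod_prod, Measure.prod_prod]
  exact ENNReal.mul_lt_top (measure_lt_top _ _)
    (ENNReal.mul_lt_top measure_closedBall_lt_top measure_closedBall_lt_top)

lemma memLp_indicator_of_bound {α G : Type*} [MeasurableSpace α] [NormedAddCommGroup G]
    {μ : Measure α} {s : Set α} (hs : MeasurableSet s) (hμ : μ s < ∞) {f : α → G}
    (hf : AEStronglyMeasurable f μ) {M : ℝ} (hM : ∀ x ∈ s, ‖f x‖ ≤ M) (p : ℝ≥0∞) :
    MemLp (s.indicator f) p μ := by
  rw [memLp_indicator_iff_restrict hs]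
  have : IsFiniteMeasure (μ.restrict s) := ⟨by simpa using hμ⟩
  refine MemLp.of_bound hf.restrict M ?_
  filter_upwards [ae_restrict_mem hs] with x hx using hM x hx

variable {Ω : Type*} [MeasurableSpace Ω] {P : Measure Ω} {T : ℝ≥0}
  {Xn Yn : ℕ → ℝ≥0 → Ω → EuclideanSpace ℝ (Fin d)} {X Y : ℝ≥0 → Ω → EuclideanSpace ℝ (Fin d)}

lemma lintegral_map_prodMk (hY : Measurable (Function.uncurry Y))
    {g : ℝ≥0 × EuclideanSpace ℝ (Fin d) × EuclideanSpace ℝ (Fin d) → ℝ≥0∞} (hg : Measurable g)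
    (t : ℝ≥0) (x : EuclideanSpace ℝ (Fin d)) :
    ∫⁻ y, g (t, x, y) ∂(P.map (Y t)) = ∫⁻ ω', g (t, x, Y t ω') ∂P :=
  lintegral_map (hg.comp (measurable_const.prodMk (measurable_const.prodMk measurable_id)))
    (hY.comp measurable_prodMk_left)

variable [IsProbabilityMeasure P]

lemma lintegral_jointLaw_eq_lintegral_map (hX : Measurable (Function.uncurry X))
    (hY : Measurable (Function.uncurry Y))
    {g : ℝ≥0 × EuclideanSpace ℝ (Fin d) × EuclideanSpace ℝ (Fin d) → ℝ≥0∞} (hg : Measurable g) :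
    ∫⁻ a, g a ∂(jointLaw P T X Y) =
      ∫⁻ t, ∫⁻ ω, ∫⁻ y, g (t, X t ω, y) ∂(P.map (Y t)) ∂P ∂(timeMeasure T) := by
  rw [lintegral_jointLaw hX hY hg]
  simp only [lintegral_map_prodMk hY hg]

/-- Puts the joint-law integral of `‖c‖` in the form of a mean-field integral with the scalar kernel
`‖c‖`, to which the convergence result for continuous kernels applies. -/
lemma lintegral_enorm_jointLaw_eq (hX : Measurable (Function.uncurry X))
    (hY : Measurable (Function.uncurry Y)) {G : Type*} [NormedAddCommGroup G]
    {c : ℝ≥0 × EuclideanSpace ℝ (Fin d) × EuclideanSpace ℝ (Fin d) → G} (hc : Continuous c)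
    (hcs : HasCompactSupport c) :
    ∫⁻ a, ‖c a‖ₑ ∂(jointLaw P T X Y) =
      ∫⁻ t, ∫⁻ ω, ‖∫ y, ‖c (t, X t ω, y)‖ ∂(P.map (Y t))‖ₑ ∂P ∂(timeMeasure T) := by
  obtain ⟨M, hM⟩ := hcs.exists_bound_of_continuous hc
  rw [lintegral_jointLaw_eq_lintegral_map hX hY hc.enorm.measurable]
  refine lintegral_congr fun t => lintegral_congr fun ω => ?_
  have hm : Continuous fun y => ‖c (t, X t ω, y)‖ := by fun_prop
  rw [Real.enorm_of_nonneg (integral_nonneg fun _ => norm_nonneg _),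
    ofReal_integral_eq_lintegral_ofReal (Integrable.of_bound hm.aestronglyMeasurable M
      (Eventually.of_forall fun y => by simpa using hM _))
      (Eventually.of_forall fun _ => norm_nonneg _)]
  simp only [ofReal_norm]

/-- Bounds of nonnegative integrals under joint laws that are uniformly absolutely continuous
persist in the limit. -/
lemma lintegral_jointLaw_le_of_forall (hXn : ∀ n, Measurable (Function.uncurry (Xn n)))
    (hYn : ∀ n, Measurable (Function.uncurry (Yn n)))
    (hX : Measurable (Function.uncurry X)) (hY : Measurable (Function.uncurry Y))
    (hXconv : ∀ t, ∀ᵐ ω ∂P, Tendsto (fun n => Xn n t ω) atTop (𝓝 (X t ω)))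
    (hYconv : ∀ t, TendstoInDistribution (fun n => Yn n t) atTop (Y t) (fun _ => P) P)
    {p : ℝ} (hp : 1 ≤ p) {C : ℝ≥0∞} (hC : C ≠ ∞)
    (hac : ∀ n, ∀ g : ℝ≥0 × EuclideanSpace ℝ (Fin d) × EuclideanSpace ℝ (Fin d) → ℝ≥0∞,
      Measurable g → ∫⁻ a, g a ∂(jointLaw P T (Xn n) (Yn n)) ≤ C * powNorm p (refMeasure d T) g)
    {g : ℝ≥0 × EuclideanSpace ℝ (Fin d) × EuclideanSpace ℝ (Fin d) → ℝ≥0∞} (hg : Measurable g)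
    {K : ℝ≥0∞} (hK : ∀ n, ∫⁻ a, g a ∂(jointLaw P T (Xn n) (Yn n)) ≤ K) :
    ∫⁻ a, g a ∂(jointLaw P T X Y) ≤ K := by
  have hp0 : 0 < p := by linarith
  set m := jointLaw P T X Y with hm
  -- Cutting `g` off in height and in space makes it an `L^p` function; Fatou removes the cut-off.
  refine lintegral_le_of_forall_tendsto
    (F := fun k : ℕ => (spaceBox d k).indicator fun a => min (g a) k)
    (fun k => (hg.min measurable_const).indicator (measurableSet_spaceBox _)) (fun a => ?_)
    fun k => ?_
  · refine (tendsto_min_natCast (g a)).congr' ?_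
    obtain ⟨N, hN⟩ := exists_nat_ge (max ‖a.2.1‖ ‖a.2.2‖)
    filter_upwards [eventually_ge_atTop N] with k hk
    rw [Set.indicator_of_mem]
    have hk' : max ‖a.2.1‖ ‖a.2.2‖ ≤ k := hN.trans (by exact_mod_cast hk)
    simpa [spaceBox] using max_le_iff.1 hk'
  set f := (spaceBox d k).indicator fun a => (min (g a) k).toReal with hf
  have hfm : Measurable f :=
    (hg.min measurable_const).ennreal_toReal.indicator (measurableSet_spaceBox _)
  have hfe : ∀ a, ‖f a‖ₑ = (spaceBox d k).indicator (fun a => min (g a) k) a := by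
    intro a
    by_cases ha : a ∈ spaceBox d k
    · rw [hf, Set.indicator_of_mem ha, Set.indicator_of_mem ha,
        Real.enorm_of_nonneg ENNReal.toReal_nonneg, ENNReal.ofReal_toReal]
      exact ((min_le_right _ _).trans_lt (by simp)).ne
    · simp [hf, ha]
  have hfg : ∀ a, ‖f a‖ₑ ≤ g a := by
    intro a
    rw [hfe]
    exact Set.indicator_le (fun a _ => min_le_left _ _) a
  simp only [← hfe]
  have hlf : IsLocallyFiniteMeasure (refMeasure d T + m) := by
    have : IsFiniteMeasureOnCompacts (refMeasure d T + m) := ⟨fun s hs => by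
      rw [Measure.add_apply]
      exact ENNReal.add_lt_top.2 ⟨hs.measure_lt_top, hs.measure_lt_top⟩⟩
    infer_instance
  -- Absolute continuity of `m` is not yet known, so `c` must be close to `f` under `m` as well as
  -- under the reference measure. Approximating for their sum gives both.
  have hmem : MemLp f (ENNReal.ofReal p) (refMeasure d T + m) := by
    refine memLp_indicator_of_bound (M := k) (measurableSet_spaceBox _) ?_
      (hg.min measurable_const).ennreal_toReal.aestronglyMeasurable (fun a _ => ?_) _
    · rw [Measure.add_apply]
      exact ENNReal.add_lt_top.2 ⟨refMeasure_spaceBox_lt_top _ _, measure_lt_top _ _⟩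
    · rw [Real.norm_of_nonneg ENNReal.toReal_nonneg]
      refine ENNReal.toReal_le_of_le_ofReal (by positivity) ?_
      simp
  -- `δ * C` bounds the error under the approximating laws, and the power of `T` comes from passing
  -- from `L^p(m)` to `L^1(m)`.
  refine ENNReal.le_of_forall_le_add_mul (D := C + (T : ℝ≥0∞) ^ (1 / 1 - 1 / p)) ?_ fun δ hδ => ?_
  · refine ENNReal.add_ne_top.2 ⟨hC, ENNReal.rpow_ne_top_of_nonneg ?_ (by simp)⟩
    have : 1 / p ≤ 1 := by rw [div_le_one hp0]; exact hp
    linarith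
  obtain ⟨c, hcs, hcδ, hc, -⟩ :=
    hmem.exists_hasCompactSupport_eLpNorm_sub_le ENNReal.ofReal_ne_top hδ
  have hdm : Measurable fun a => ‖f a - c a‖ₑ := (hfm.sub hc.measurable).enorm
  rw [eLpNorm_eq_powNorm hp0] at hcδ
  have hδle : ∀ μ ≤ refMeasure d T + m, powNorm p μ (fun a => ‖f a - c a‖ₑ) ≤ δ := by
    intro μ hμ
    refine le_trans ?_ hcδ
    unfold powNorm
    gcongr
    rfl
  have h1 : ∫⁻ a, ‖f a - c a‖ₑ ∂m ≤ δ * (T : ℝ≥0∞) ^ (1 / 1 - 1 / p) := by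
    have h := powNorm_le_mul_measure_univ (μ := m) one_pos hp hdm
    rw [jointLaw_univ hX hY] at h
    simp only [powNorm, ENNReal.rpow_one, div_one] at h
    refine h.trans ?_
    rw [div_one]
    gcongr
    exact hδle m (Measure.le_add_left le_rfl)
  have h2 : ∀ n, ∫⁻ a, ‖f a - c a‖ₑ ∂(jointLaw P T (Xn n) (Yn n)) ≤ δ * C := by
    intro n
    rw [mul_comm]
    refine (hac n _ hdm).trans ?_
    gcongr
    exact hδle _ (Measure.le_add_right le_rfl)
  have hlim := tendsto_lintegral_enorm_sub_of_hasCompactSupport (T := T) hXn hYn hX hY hXconv hYconv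
    hc.norm hcs.norm
  have hcn : ∀ n, ∫⁻ a, ‖c a‖ₑ ∂(jointLaw P T (Xn n) (Yn n)) ≤ K + δ * C := by
    intro n
    calc _ ≤ ∫⁻ a, (‖f a‖ₑ + ‖f a - c a‖ₑ) ∂(jointLaw P T (Xn n) (Yn n)) := by
          refine lintegral_mono fun a => ?_
          have : c a = f a - (f a - c a) := by abel
          conv_lhs => rw [this]
          exact enorm_sub_le
      _ = ∫⁻ a, ‖f a‖ₑ ∂(jointLaw P T (Xn n) (Yn n)) +
          ∫⁻ a, ‖f a - c a‖ₑ ∂(jointLaw P T (Xn n) (Yn n)) := lintegral_add_left hfm.enorm _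
      _ ≤ _ := add_le_add ((lintegral_mono hfg).trans (hK n)) (h2 n)
  have hcm : ∫⁻ a, ‖c a‖ₑ ∂m ≤ K + δ * C := by
    have hle : ∀ n, ∫⁻ a, ‖c a‖ₑ ∂m ≤ K + δ * C + ∫⁻ t, ∫⁻ ω,
        ‖∫ y, ‖c (t, Xn n t ω, y)‖ ∂(P.map (Yn n t)) -
          ∫ y, ‖c (t, X t ω, y)‖ ∂(P.map (Y t))‖ₑ ∂P ∂(timeMeasure T) := by
      intro n
      refine le_trans ?_ (add_le_add (hcn n) le_rfl)
      rw [lintegral_enorm_jointLaw_eq hX hY hc hcs,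
        lintegral_enorm_jointLaw_eq (hXn n) (hYn n) hc hcs]
      have hmn := stronglyMeasurable_integral_map (P := P) (hXn n) (hYn n) hc.norm.stronglyMeasurable
      rw [← lintegral_add_left hmn.enorm.lintegral_prod_right']
      refine lintegral_mono fun t => ?_
      have hmt : Measurable fun ω => ‖∫ y, ‖c (t, Xn n t ω, y)‖ ∂(P.map (Yn n t))‖ₑ :=
        hmn.enorm.comp measurable_prodMk_left
      refine le_trans (lintegral_mono fun ω => ?_) (lintegral_add_left hmt _).le
      exact (enorm_sub_le (a := ∫ y, ‖c (t, Xn n t ω, y)‖ ∂(P.map (Yn n t)))).trans' (by simp)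
    have := (tendsto_const_nhds (x := K + δ * C)).add hlim
    rw [add_zero] at this
    exact ge_of_tendsto' this hle
  calc ∫⁻ a, ‖f a‖ₑ ∂m ≤ ∫⁻ a, (‖c a‖ₑ + ‖f a - c a‖ₑ) ∂m := by
        refine lintegral_mono fun a => ?_
        refine le_trans ?_ (enorm_add_le _ _)
        simp
    _ = ∫⁻ a, ‖c a‖ₑ ∂m + ∫⁻ a, ‖f a - c a‖ₑ ∂m := lintegral_add_left hc.enorm.measurable _
    _ ≤ K + δ * C + δ * (T : ℝ≥0∞) ^ (1 / 1 - 1 / p) := add_le_add hcm h1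
    _ = _ := by rw [add_assoc, ← mul_add]

/-- A measurable kernel is approximated by a continuous one with compact support, in `L^1`
uniformly over a tight and uniformly absolutely continuous family of measures for which its
`γ`-moments are bounded. -/
lemma exists_hasCompactSupport_forall_lintegral_le {G : Type*} [NormedAddCommGroup G]
    [NormedSpace ℝ G] [MeasurableSpace G] [BorelSpace G] [SecondCountableTopology G]
    {h : ℝ≥0 × EuclideanSpace ℝ (Fin d) × EuclideanSpace ℝ (Fin d) → G} (hh : Measurable h)
    {p γ β : ℝ} (hp : 0 < p) (hγ : 1 < γ) (hβ : 0 < β) {C K L ε : ℝ≥0∞} (hC : C ≠ ∞) (hK : K ≠ ∞)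
    (hL : L ≠ ∞) (hε : ε ≠ 0) :
    ∃ c : ℝ≥0 × EuclideanSpace ℝ (Fin d) × EuclideanSpace ℝ (Fin d) → G,
      Continuous c ∧ HasCompactSupport c ∧
      ∀ m : Measure (ℝ≥0 × EuclideanSpace ℝ (Fin d) × EuclideanSpace ℝ (Fin d)),
        (∀ g : ℝ≥0 × EuclideanSpace ℝ (Fin d) × EuclideanSpace ℝ (Fin d) → ℝ≥0∞,
          Measurable g → ∫⁻ a, g a ∂m ≤ C * powNorm p (refMeasure d T) g) →
        ∫⁻ a, ‖h a‖ₑ ^ γ ∂m ≤ K → ∫⁻ a, (‖a.2.1‖ₑ ^ β + ‖a.2.2‖ₑ ^ β) ∂m ≤ L →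
        ∫⁻ a, ‖h a - c a‖ₑ ∂m ≤ ε := by
  have hε3 : ε / 3 ≠ 0 := by simp [hε, ENNReal.div_eq_zero_iff]
  -- `M` makes the part with `‖h‖ > M` small through the `γ`-moment. `R` is chosen after it, because
  -- outside the box the remaining part is bounded by `M` times a tail probability.
  obtain ⟨M, hM0, hM⟩ := exists_nat_rpow_neg_mul_le (a := γ - 1) (by linarith) hK hε3
  obtain ⟨R, hR0, hR⟩ := exists_nat_rpow_neg_mul_le hβ (K := M * L)
    (ENNReal.mul_ne_top (by simp) hL) hε3
  set A := {a | ‖h a‖ₑ ≤ M} ∩ spaceBox d R with hA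
  have hAm : MeasurableSet A :=
    (measurableSet_le hh.enorm measurable_const).inter (measurableSet_spaceBox _)
  have hmem : MemLp (A.indicator h) (ENNReal.ofReal p) (refMeasure d T) := by
    refine memLp_indicator_of_bound (M := M) hAm
      ((measure_mono Set.inter_subset_right).trans_lt (refMeasure_spaceBox_lt_top _ _))
      hh.aestronglyMeasurable (fun a ha => ?_) _
    have h1 : ‖h a‖ₑ ≤ M := ha.1
    rw [← ofReal_norm, ← ENNReal.ofReal_natCast] at h1
    exact (ENNReal.ofReal_le_ofReal_iff (by positivity)).1 h1
  -- The tolerance absorbs the absolute continuity constant; `C + 1` avoids dividing by zero.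
  have hδ : ε / 3 / (C + 1) ≠ 0 :=
    ENNReal.div_ne_zero.2 ⟨hε3, ENNReal.add_ne_top.2 ⟨hC, by simp⟩⟩
  obtain ⟨c, hcs, hcδ, hc, -⟩ :=
    hmem.exists_hasCompactSupport_eLpNorm_sub_le ENNReal.ofReal_ne_top hδ
  refine ⟨c, hc, hcs, fun m hac hmK hmL => ?_⟩
  rw [eLpNorm_eq_powNorm hp] at hcδ
  have hpt : ∀ a, ‖h a - c a‖ₑ ≤ (M : ℝ≥0∞) ^ (-(γ - 1)) * ‖h a‖ₑ ^ γ +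
      (R : ℝ≥0∞) ^ (-β) * (M * (‖a.2.1‖ₑ ^ β + ‖a.2.2‖ₑ ^ β)) + ‖A.indicator h a - c a‖ₑ := by
    intro a
    by_cases ha : a ∈ A
    · rw [Set.indicator_of_mem ha]
      exact le_add_self
    have hsub : ‖h a - c a‖ₑ ≤ ‖h a‖ₑ + ‖A.indicator h a - c a‖ₑ := by
      rw [Set.indicator_of_notMem ha, zero_sub, enorm_neg]
      exact enorm_sub_le
    refine hsub.trans (add_le_add ?_ le_rfl)
    rcases le_or_gt ‖h a‖ₑ (M : ℝ≥0∞) with hle | hlt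
    · refine le_trans ?_ le_add_self
      have hbox : ¬ (‖a.2.1‖ ≤ R ∧ ‖a.2.2‖ ≤ R) := by
        intro hb
        exact ha ⟨hle, by simpa [spaceBox] using hb⟩
      have hone : 1 ≤ (R : ℝ≥0∞) ^ (-β) * (‖a.2.1‖ₑ ^ β + ‖a.2.2‖ₑ ^ β) := by
        have hcast : ∀ x : EuclideanSpace ℝ (Fin d), (R : ℝ) < ‖x‖ → (R : ℝ≥0∞) ≤ ‖x‖ₑ := by
          intro x hx
          rw [← ofReal_norm, ← ENNReal.ofReal_natCast]
          exact ENNReal.ofReal_le_ofReal hx.le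
        rw [mul_add]
        rcases not_and_or.1 hbox with hx | hy
        · exact (one_le_rpow_neg_mul_rpow hβ.le hR0 (hcast _ (not_le.1 hx))).trans le_self_add
        · exact (one_le_rpow_neg_mul_rpow hβ.le hR0 (hcast _ (not_le.1 hy))).trans le_add_self
      calc ‖h a‖ₑ ≤ M * 1 := by rwa [mul_one]
        _ ≤ M * ((R : ℝ≥0∞) ^ (-β) * (‖a.2.1‖ₑ ^ β + ‖a.2.2‖ₑ ^ β)) := by gcongr
        _ = _ := by ring
    · refine le_trans ?_ le_self_add
      have hone := one_le_rpow_neg_mul_rpow (a := γ - 1) (by linarith) hM0 hlt.le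
      have hsplit : ‖h a‖ₑ ^ γ = ‖h a‖ₑ ^ (γ - 1) * ‖h a‖ₑ := by
        conv_rhs => rw [← ENNReal.rpow_one ‖h a‖ₑ, ← ENNReal.rpow_mul, one_mul]
        rw [← ENNReal.rpow_add_of_nonneg _ _ (by linarith) zero_le_one]
        simp
      rw [hsplit, ← mul_assoc]
      exact le_mul_of_one_le_left zero_le hone
  have hm1 : Measurable fun a => ‖h a‖ₑ ^ γ := hh.enorm.pow_const _
  have hm2 : Measurable fun a : ℝ≥0 × EuclideanSpace ℝ (Fin d) × EuclideanSpace ℝ (Fin d) =>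
      ‖a.2.1‖ₑ ^ β + ‖a.2.2‖ₑ ^ β := by fun_prop
  have hm3 : Measurable fun a => ‖A.indicator h a - c a‖ₑ :=
    ((hh.indicator hAm).sub hc.measurable).enorm
  calc ∫⁻ a, ‖h a - c a‖ₑ ∂m ≤ _ := lintegral_mono hpt
    _ = (M : ℝ≥0∞) ^ (-(γ - 1)) * ∫⁻ a, ‖h a‖ₑ ^ γ ∂m +
        (R : ℝ≥0∞) ^ (-β) * (M * ∫⁻ a, (‖a.2.1‖ₑ ^ β + ‖a.2.2‖ₑ ^ β) ∂m) +
        ∫⁻ a, ‖A.indicator h a - c a‖ₑ ∂m := by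
      rw [lintegral_add_right _ hm3, lintegral_add_left (hm1.const_mul _),
        lintegral_const_mul _ hm1, lintegral_const_mul _ (hm2.const_mul _),
        lintegral_const_mul _ hm2]
    _ ≤ ε / 3 + ε / 3 + ε / 3 := by
      refine add_le_add (add_le_add ?_ ?_) ?_
      · exact le_trans (by gcongr) hM
      · exact le_trans (by gcongr) hR
      · refine (hac _ hm3).trans ?_
        calc _ ≤ (C + 1) * (ε / 3 / (C + 1)) := by
              gcongr
              · exact le_self_add
              · exact hcδ
          _ ≤ _ := ENNReal.mul_div_le
    _ = ε := ENNReal.add_thirds ε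

end Approximation

/-! ### From kernels to drifts: the three-term estimate. -/

section MeanFieldConvergence

variable {d : ℕ} {Ω : Type*} [MeasurableSpace Ω] {P : Measure Ω} [IsProbabilityMeasure P]
  {G : Type*} [NormedAddCommGroup G] {T : ℝ≥0}
  {X Y : ℝ≥0 → Ω → EuclideanSpace ℝ (Fin d)}

lemma ae_integrable_map_of_lintegral_jointLaw_ne_top (hX : Measurable (Function.uncurry X))
    (hY : Measurable (Function.uncurry Y))
    {h : ℝ≥0 × EuclideanSpace ℝ (Fin d) × EuclideanSpace ℝ (Fin d) → G}
    (hh : StronglyMeasurable h) (hfin : ∫⁻ a, ‖h a‖ₑ ∂(jointLaw P T X Y) ≠ ∞) :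
    ∀ᵐ a ∂((timeMeasure T).prod P),
      Integrable (fun y => h (a.1, X a.1 a.2, y)) (P.map (Y a.1)) := by
  have hX' : Measurable fun a : ℝ≥0 × Ω => X a.1 a.2 := hX
  have hY' : Measurable fun a : ℝ≥0 × Ω => Y a.1 a.2 := hY
  have hm : Measurable fun a : ℝ≥0 × Ω => ∫⁻ ω', ‖h (a.1, X a.1 a.2, Y a.1 ω')‖ₑ ∂P := by
    refine Measurable.lintegral_prod_right'
      (f := fun b : (ℝ≥0 × Ω) × Ω => ‖h (b.1.1, X b.1.1 b.1.2, Y b.1.1 b.2)‖ₑ) ?_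
    exact hh.enorm.comp (measurable_fst.fst.prodMk ((hX'.comp measurable_fst).prodMk
      (hY'.comp (measurable_fst.fst.prodMk measurable_snd))))
  rw [lintegral_jointLaw hX hY hh.enorm, ← lintegral_prod (fun a : ℝ≥0 × Ω =>
    ∫⁻ ω', ‖h (a.1, X a.1 a.2, Y a.1 ω')‖ₑ ∂P) hm.aemeasurable] at hfin
  filter_upwards [ae_lt_top hm hfin] with a ha
  refine ⟨(hh.comp_measurable (measurable_const.prodMk
    (measurable_const.prodMk measurable_id))).aestronglyMeasurable, ?_⟩
  rw [hasFiniteIntegral_iff_enorm, lintegral_map_prodMk hY hh.enorm]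
  exact ha

lemma ae_ae_integrable_of_lintegral_jointLaw_ne_top (hX : Measurable (Function.uncurry X))
    (hY : Measurable (Function.uncurry Y))
    {h : ℝ≥0 × EuclideanSpace ℝ (Fin d) × EuclideanSpace ℝ (Fin d) → G}
    (hh : StronglyMeasurable h) (hfin : ∫⁻ a, ‖h a‖ₑ ∂(jointLaw P T X Y) ≠ ∞) :
    ∀ᵐ ω ∂P, ∀ᵐ t ∂(timeMeasure T),
      Integrable (fun y => h (t, X t ω, y)) (P.map (Y t)) :=
  Measure.ae_ae_of_ae_prod (Measure.measurePreserving_swap.quasiMeasurePreserving.ae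
    (ae_integrable_map_of_lintegral_jointLaw_ne_top hX hY hh hfin))

/-- Replacing the kernel costs at most its `L^1` distance under the joint law. Finiteness is needed
to subtract the inner Bochner integrals, which default to zero when they diverge. -/
lemma lintegral_enorm_integral_sub_le [NormedSpace ℝ G] (hX : Measurable (Function.uncurry X))
    (hY : Measurable (Function.uncurry Y))
    {h c : ℝ≥0 × EuclideanSpace ℝ (Fin d) × EuclideanSpace ℝ (Fin d) → G}
    (hh : StronglyMeasurable h) (hc : StronglyMeasurable c)
    (hhfin : ∫⁻ a, ‖h a‖ₑ ∂(jointLaw P T X Y) ≠ ∞) (hcfin : ∫⁻ a, ‖c a‖ₑ ∂(jointLaw P T X Y) ≠ ∞) :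
    ∫⁻ a, ‖∫ y, h (a.1, X a.1 a.2, y) ∂(P.map (Y a.1)) -
      ∫ y, c (a.1, X a.1 a.2, y) ∂(P.map (Y a.1))‖ₑ ∂((timeMeasure T).prod P) ≤
      ∫⁻ a, ‖h a - c a‖ₑ ∂(jointLaw P T X Y) := by
  have hX' : Measurable fun a : ℝ≥0 × Ω => X a.1 a.2 := hX
  have hY' : Measurable fun a : ℝ≥0 × Ω => Y a.1 a.2 := hY
  have hm : Measurable fun a : ℝ≥0 × Ω =>
      ∫⁻ ω', ‖h (a.1, X a.1 a.2, Y a.1 ω') - c (a.1, X a.1 a.2, Y a.1 ω')‖ₑ ∂P := by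
    refine Measurable.lintegral_prod_right' (f := fun b : (ℝ≥0 × Ω) × Ω =>
      ‖h (b.1.1, X b.1.1 b.1.2, Y b.1.1 b.2) - c (b.1.1, X b.1.1 b.1.2, Y b.1.1 b.2)‖ₑ) ?_
    exact (hh.sub hc).enorm.comp (measurable_fst.fst.prodMk ((hX'.comp measurable_fst).prodMk
      (hY'.comp (measurable_fst.fst.prodMk measurable_snd))))
  rw [lintegral_jointLaw hX hY (g := fun a => ‖h a - c a‖ₑ) (hh.sub hc).enorm,
    ← lintegral_prod (fun a : ℝ≥0 × Ω =>
    ∫⁻ ω', ‖h (a.1, X a.1 a.2, Y a.1 ω') - c (a.1, X a.1 a.2, Y a.1 ω')‖ₑ ∂P) hm.aemeasurable]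
  refine lintegral_mono_ae ?_
  filter_upwards [ae_integrable_map_of_lintegral_jointLaw_ne_top hX hY hh hhfin,
    ae_integrable_map_of_lintegral_jointLaw_ne_top hX hY hc hcfin] with a h1 h2
  rw [← integral_sub h1 h2]
  refine (enorm_integral_le_lintegral_enorm _).trans_eq ?_
  exact lintegral_map_prodMk hY (g := fun a => ‖h a - c a‖ₑ) (hh.sub hc).enorm a.1 _

lemma lintegral_enorm_sub_le_add_add {α : Type*} [MeasurableSpace α] {μ : Measure α}
    {u v u' v' : α → G} (hu : StronglyMeasurable u) (hu' : StronglyMeasurable u')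
    (hv' : StronglyMeasurable v') :
    ∫⁻ a, ‖u a - v a‖ₑ ∂μ ≤
      ∫⁻ a, ‖u a - u' a‖ₑ ∂μ + ∫⁻ a, ‖u' a - v' a‖ₑ ∂μ + ∫⁻ a, ‖v a - v' a‖ₑ ∂μ := by
  have h1 : Measurable fun a => ‖u a - u' a‖ₑ := (hu.sub hu').enorm
  have h2 : Measurable fun a => ‖u' a - v' a‖ₑ := (hu'.sub hv').enorm
  have h12 : Measurable fun a => ‖u a - u' a‖ₑ + ‖u' a - v' a‖ₑ := h1.add h2
  rw [← lintegral_add_left h1, ← lintegral_add_left h12]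
  refine lintegral_mono fun a => ?_
  simp only [← edist_eq_enorm_sub]
  rw [edist_comm (v a)]
  exact edist_triangle4 (u a) (u' a) (v' a) (v a)

/-- Mean-field drifts along converging processes converge in `L^1`, if their joint laws are
uniformly absolutely continuous and tight and the kernel has bounded `γ`-moments. -/
lemma tendsto_lintegral_enorm_sub_of_moment_le [NormedSpace ℝ G] [FiniteDimensional ℝ G]
    [MeasurableSpace G] [BorelSpace G] {Xn Yn : ℕ → ℝ≥0 → Ω → EuclideanSpace ℝ (Fin d)}
    (hXn : ∀ n, Measurable (Function.uncurry (Xn n)))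
    (hYn : ∀ n, Measurable (Function.uncurry (Yn n)))
    (hX : Measurable (Function.uncurry X)) (hY : Measurable (Function.uncurry Y))
    (hXconv : ∀ t, ∀ᵐ ω ∂P, Tendsto (fun n => Xn n t ω) atTop (𝓝 (X t ω)))
    (hYconv : ∀ t, TendstoInDistribution (fun n => Yn n t) atTop (Y t) (fun _ => P) P)
    {p γ β : ℝ} (hp : 1 ≤ p) (hγ : 1 < γ) (hβ : 0 < β) {C K L : ℝ≥0∞} (hC : C ≠ ∞) (hK : K ≠ ∞)
    (hL : L ≠ ∞)
    {h : ℝ≥0 × EuclideanSpace ℝ (Fin d) × EuclideanSpace ℝ (Fin d) → G} (hh : Measurable h)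
    (hac : ∀ n, ∀ g : ℝ≥0 × EuclideanSpace ℝ (Fin d) × EuclideanSpace ℝ (Fin d) → ℝ≥0∞,
      Measurable g → ∫⁻ a, g a ∂(jointLaw P T (Xn n) (Yn n)) ≤ C * powNorm p (refMeasure d T) g)
    (hmom : ∀ n, ∫⁻ a, ‖h a‖ₑ ^ γ ∂(jointLaw P T (Xn n) (Yn n)) ≤ K)
    (htight : ∀ n, ∫⁻ a, (‖a.2.1‖ₑ ^ β + ‖a.2.2‖ₑ ^ β) ∂(jointLaw P T (Xn n) (Yn n)) ≤ L) :
    (∀ n, ∀ᵐ ω ∂P, ∀ᵐ t ∂(timeMeasure T),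
      Integrable (fun y => h (t, Xn n t ω, y)) (P.map (Yn n t))) ∧
    (∀ᵐ ω ∂P, ∀ᵐ t ∂(timeMeasure T),
      Integrable (fun y => h (t, X t ω, y)) (P.map (Y t))) ∧
    Tendsto (fun n => ∫⁻ ω, ∫⁻ t, ‖∫ y, h (t, Xn n t ω, y) ∂(P.map (Yn n t)) -
      ∫ y, h (t, X t ω, y) ∂(P.map (Y t))‖ₑ ∂(timeMeasure T) ∂P) atTop (𝓝 0) := by
  have : ProperSpace G := FiniteDimensional.proper ℝ G
  have hhs : StronglyMeasurable h := hh.stronglyMeasurable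
  have htrans : ∀ {g : ℝ≥0 × EuclideanSpace ℝ (Fin d) × EuclideanSpace ℝ (Fin d) → ℝ≥0∞},
      Measurable g → ∀ {K}, (∀ n, ∫⁻ a, g a ∂(jointLaw P T (Xn n) (Yn n)) ≤ K) →
      ∫⁻ a, g a ∂(jointLaw P T X Y) ≤ K := fun hg _ hK =>
    lintegral_jointLaw_le_of_forall hXn hYn hX hY hXconv hYconv hp hC hac hg hK
  have hfin : ∀ {Z W : ℝ≥0 → Ω → EuclideanSpace ℝ (Fin d)},
      ∫⁻ a, ‖h a‖ₑ ^ γ ∂(jointLaw P T Z W) ≤ K → ∫⁻ a, ‖h a‖ₑ ∂(jointLaw P T Z W) ≠ ∞ := by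
    intro Z W hZW
    have hle : ∀ a, ‖h a‖ₑ ≤ 1 + ‖h a‖ₑ ^ γ := by
      intro a
      rcases le_total ‖h a‖ₑ 1 with h1 | h1
      · exact h1.trans le_self_add
      · refine le_trans ?_ le_add_self
        conv_lhs => rw [← ENNReal.rpow_one ‖h a‖ₑ]
        exact ENNReal.rpow_le_rpow_of_exponent_le h1 hγ.le
    refine ((lintegral_mono hle).trans_lt ?_).ne
    rw [lintegral_add_left measurable_const]
    exact ENNReal.add_lt_top.2 ⟨by simp, hZW.trans_lt hK.lt_top⟩
  have hmomX := htrans (hh.enorm.pow_const γ) hmom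
  have hfinn := fun n => hfin (hmom n)
  have hfinX := hfin hmomX
  refine ⟨fun n => ae_ae_integrable_of_lintegral_jointLaw_ne_top (hXn n) (hYn n) hhs (hfinn n),
    ae_ae_integrable_of_lintegral_jointLaw_ne_top hX hY hhs hfinX, ?_⟩
  rw [ENNReal.tendsto_nhds_zero]
  intro ε hε
  have hε3 : ε / 3 ≠ 0 := by simp [hε.ne', ENNReal.div_eq_zero_iff]
  obtain ⟨c, hc, hcs, hcε⟩ := exists_hasCompactSupport_forall_lintegral_le (T := T) hh
    (by linarith : 0 < p) hγ hβ hC hK hL hε3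
  have hcn := fun n => hcε _ (hac n) (hmom n) (htight n)
  -- The limit law inherits absolute continuity, the `γ`-moment and tightness through `htrans`, so
  -- the same `c` serves for it.
  have hcX := hcε _ (fun g hg => htrans hg fun n => hac n g hg) hmomX
    (htrans (by fun_prop) htight)
  obtain ⟨B, hB⟩ := hcs.exists_bound_of_continuous hc
  have hcfin : ∀ Z W : ℝ≥0 → Ω → EuclideanSpace ℝ (Fin d),
      ∫⁻ a, ‖c a‖ₑ ∂(jointLaw P T Z W) ≠ ∞ := fun Z W =>
    (Integrable.of_bound hc.aestronglyMeasurable B (Eventually.of_forall hB)).2.ne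
  have hlim := tendsto_lintegral_enorm_sub_of_hasCompactSupport (T := T) hXn hYn hX hY hXconv
    hYconv hc hcs
  filter_upwards [ENNReal.tendsto_nhds_zero.1 hlim (ε / 3) (pos_iff_ne_zero.2 hε3)] with n hn
  have hcm := hc.stronglyMeasurable
  have hm := stronglyMeasurable_integral_map (P := P) (hXn n) (hYn n) hhs
  have hm' := stronglyMeasurable_integral_map (P := P) hX hY hhs
  have hmc := stronglyMeasurable_integral_map (P := P) (hXn n) (hYn n) hcm
  have hmc' := stronglyMeasurable_integral_map (P := P) hX hY hcm
  have hswap : ∫⁻ ω, ∫⁻ t, ‖∫ y, h (t, Xn n t ω, y) ∂(P.map (Yn n t)) -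
      ∫ y, h (t, X t ω, y) ∂(P.map (Y t))‖ₑ ∂(timeMeasure T) ∂P =
      ∫⁻ a, ‖∫ y, h (a.1, Xn n a.1 a.2, y) ∂(P.map (Yn n a.1)) -
        ∫ y, h (a.1, X a.1 a.2, y) ∂(P.map (Y a.1))‖ₑ ∂((timeMeasure T).prod P) :=
    (lintegral_prod_symm _ (hm.sub hm').enorm.aemeasurable).symm
  have hn' : ∫⁻ a, ‖∫ y, c (a.1, Xn n a.1 a.2, y) ∂(P.map (Yn n a.1)) -
      ∫ y, c (a.1, X a.1 a.2, y) ∂(P.map (Y a.1))‖ₑ ∂((timeMeasure T).prod P) ≤ ε / 3 :=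
    (lintegral_prod _ (hmc.sub hmc').enorm.aemeasurable).trans_le hn
  rw [hswap, ← ENNReal.add_thirds ε]
  exact (lintegral_enorm_sub_le_add_add hm hmc hmc').trans (add_le_add (add_le_add
    ((lintegral_enorm_integral_sub_le (hXn n) (hYn n) hhs hcm (hfinn n) (hcfin _ _)).trans (hcn n))
    hn') ((lintegral_enorm_integral_sub_le hX hY hhs hcm hfinX (hcfin _ _)).trans hcX))

end MeanFieldConvergence

/-! ### The main theorem: verification of the uniform bounds. -/

theorem lemma2p9 {d : ℕ} {F : Type*} [NormedAddCommGroup F] [NormedSpace ℝ F]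
    [FiniteDimensional ℝ F] [MeasurableSpace F] [BorelSpace F]
    {Ω : Type*} [MeasurableSpace Ω] (P : Measure Ω) [IsProbabilityMeasure P]
    -- the cut-off function and the radius used in the localized norms
    (χ : EuclideanSpace ℝ (Fin d) → ℝ) (hχ : IsCutoff χ) (r : ℝ) (hr : 0 < r)
    (Xn Yn : ℕ → ℝ≥0 → Ω → EuclideanSpace ℝ (Fin d))
    (X Y : ℝ≥0 → Ω → EuclideanSpace ℝ (Fin d))
    (hXn : ∀ n, IsStochContProcess P (Xn n)) (hYn : ∀ n, IsStochContProcess P (Yn n))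
    (hX : IsStochContProcess P X) (hY : IsStochContProcess P Y)
    (hXconv : ∀ t, ∀ᵐ ω ∂P, Tendsto (fun n => Xn n t ω) atTop (𝓝 (X t ω)))
    (hYconv : ∀ t, TendstoInDistribution (fun n => Yn n t) atTop (Y t) (fun _ => P) P)
    (p₁ p₂ q₀ q₁ q₂ : ℝ) (hp₁ : 1 < p₁) (hp₂ : 1 < p₂)
    (hq₀ : 1 < q₀) (hq₁ : 1 < q₁) (hq₂ : 1 < q₂) (hq : 1 / q₁ + 1 / q₂ = 1 + 1 / q₀)
    (T κ : ℝ≥0) (β : ℝ) (hT : 0 < T) (hκ : 0 < κ) (hβ : 0 < β)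
    (hXK : ∀ n, KrylovEstimate P χ r (ENNReal.ofReal p₁) (ENNReal.ofReal q₁) T κ (Xn n))
    (hYK : ∀ n, KrylovEstimate P χ r (ENNReal.ofReal p₂) (ENNReal.ofReal q₂) T κ (Yn n))
    (C₁ : ℝ≥0)
    (hmom : ∀ n, ∀ t ≤ T, ∫⁻ ω, (‖Xn n t ω‖ₑ ^ β + ‖Yn n t ω‖ₑ ^ β) ∂P ≤ C₁)
    (γ : ℝ) (hγ : 1 < γ)
    (bbar : ℝ≥0 → EuclideanSpace ℝ (Fin d) → EuclideanSpace ℝ (Fin d) → F)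
    (hb : MemLocMixed (ENNReal.ofReal (γ * p₁)) (ENNReal.ofReal (γ * p₂))
      (ENNReal.ofReal (γ * q₀)) T bbar) :
    -- the integrals defining the drifts along the processes exist almost everywhere
    (∀ n, ∀ᵐ ω ∂P, ∀ᵐ t ∂(timeMeasure T),
      Integrable (fun y => bbar t (Xn n t ω) y) (P.map (Yn n t))) ∧
    (∀ᵐ ω ∂P, ∀ᵐ t ∂(timeMeasure T),
      Integrable (fun y => bbar t (X t ω) y) (P.map (Y t))) ∧
    Tendsto
      (fun n => ∫⁻ ω, ∫⁻ t,
        ‖driftAlong P (meanFieldDrift bbar) (Yn n) t (Xn n t ω)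
          - driftAlong P (meanFieldDrift bbar) Y t (X t ω)‖ₑ ∂(timeMeasure T) ∂P)
      atTop (𝓝 0) := by 
  obtain ⟨A, hA⟩ := exists_lintegral_le_cubeNorm hχ hr κ
  -- The smallest single exponent dominating the three in the mixed norm. The constant `A` above
  -- depends only on the cut-off, `r` and `κ`, so it serves both families.
  set p := max p₁ (max p₂ q₀) with hp
  have hp₁p : p₁ ≤ p := le_max_left _ _
  have hp₂p : p₂ ≤ p := (le_max_left _ _).trans (le_max_right _ _)
  have hq₀p : q₀ ≤ p := (le_max_right _ _).trans (le_max_right _ _)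
  have hbm : Measurable fun a : ℝ≥0 × EuclideanSpace ℝ (Fin d) × EuclideanSpace ℝ (Fin d) =>
      bbar a.1 a.2.1 a.2.2 := hb.1
  have hpair : ∀ n, ∀ g : ℝ≥0 × EuclideanSpace ℝ (Fin d) × EuclideanSpace ℝ (Fin d) → ℝ≥0∞,
      Measurable g → ∫⁻ a, g a ∂(jointLaw P T (Xn n) (Yn n)) ≤
        A * A * cubeMixedNorm p₁ p₂ q₀ T fun t x y => g (t, x, y) := by
    intro n g hg
    rw [lintegral_jointLaw (hXn n).measurable (hYn n).measurable hg]
    exact lintegral_pair_le_cubeMixedNorm hp₁ (by linarith) hq₀ hq₁ hq₂ hq (hYn n).measurable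
      (hA P p₁ q₁ T _ hp₁.le hq₁.le (hXn n).measurable (hXK n))
      (hA P p₂ q₂ T _ hp₂.le hq₂.le (hYn n).measurable (hYK n)) hg
  refine tendsto_lintegral_enorm_sub_of_moment_le (p := p) (γ := γ) (β := β)
    (C := A * A * (T : ℝ≥0∞) ^ (1 / q₀ - 1 / p))
    (K := A * A * locMixedNorm (ENNReal.ofReal (γ * p₁)) (ENNReal.ofReal (γ * p₂))
      (ENNReal.ofReal (γ * q₀)) T bbar ^ γ) (L := C₁ * T)
    (h := fun a => bbar a.1 a.2.1 a.2.2)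
    (fun n => (hXn n).measurable) (fun n => (hYn n).measurable) hX.measurable hY.measurable
    hXconv hYconv (hp₁.le.trans hp₁p) hγ hβ ?_ ?_ ?_ hbm ?_ ?_ ?_
  · refine ENNReal.mul_ne_top (by finiteness) (ENNReal.rpow_ne_top_of_nonneg ?_ (by simp))
    have := one_div_le_one_div_of_le (by linarith : 0 < q₀) hq₀p
    linarith
  · exact ENNReal.mul_ne_top (by finiteness)
      (ENNReal.rpow_ne_top_of_nonneg (by linarith) hb.2.ne)
  · finiteness
  · intro n g hg
    refine (hpair n g hg).trans ?_
    rw [mul_assoc (A * A : ℝ≥0∞), mul_comm ((T : ℝ≥0∞) ^ _)]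
    gcongr
    exact cubeMixedNorm_le_powNorm (by linarith) (by linarith) (by linarith) hp₁p hp₂p hq₀p T hg
  · intro n
    refine (hpair n _ (hbm.enorm.pow_const γ)).trans ?_
    gcongr
    rw [locMixedNorm_eq_cubeMixedNorm (by positivity) (by positivity) (by positivity)]
    exact cubeMixedNorm_rpow (by linarith) p₁ p₂ q₀ T fun t x y => ‖bbar t x y‖ₑ
  · intro n
    rw [lintegral_jointLaw (hXn n).measurable (hYn n).measurable (by fun_prop)]
    calc _ ≤ ∫⁻ _, (C₁ : ℝ≥0∞) ∂(timeMeasure T) := by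
          refine lintegral_mono_ae ?_
          filter_upwards [ae_timeMeasure_le T] with t ht
          refine le_trans (le_of_eq ?_) (hmom n t ht)
          have hXt : Measurable (Xn n t) := (hXn n).measurable.comp measurable_prodMk_left
          have hYt : Measurable (Yn n t) := (hYn n).measurable.comp measurable_prodMk_left
          rw [lintegral_add_left (hXt.enorm.pow_const β)]
          simp only [lintegral_add_left measurable_const, lintegral_const, measure_univ, mul_one]
          rw [lintegral_add_right _ measurable_const, lintegral_const, measure_univ, mul_one]
      _ = C₁ * T := by rw [lintegral_const, timeMeasure_univ]
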